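/- **Lemma 3.3 (Besov–Nikol'skii improvement).** Notation. Let $N\ge 1$. For $h\in\mathbb R^N$ put $\delta_h\psi(x)=\psi(x+h)-\psi(x)$ and $\delta_h^2\psi=\delta_h(\delta_h\psi)$. For $A\subset\mathbb R^N$ and $0<\alpha<1$, $[\psi]^p_{W^{\alpha,p}(A)}=\int_A\int_A\frac{|\psi(x)-\psi(y)|^p}{|x-y|^{N+\alpha p}}\,dx\,dy$, and $W^{\alpha,p}(A)$ is the set of $\psi\in L^p(A)$ for which this is finite. For $0<\alpha<2$, $\psi\in\mathcal B^{\alpha,p}_\infty(\mathbb R^N)$ means that $\psi\in L^p(\mathbb R^N)$ and $[\psi]_{\mathcal B^{\alpha,p}_\infty(\mathbb R^N)}:=\sup_{|h|>0}\big\||h|^{-\alpha}\delta^2_h\psi\big\|_{L^p(\mathbb R^N)}<\infty$. Let $p\ge 2$ and let $c_N$ be a constant. There is a constant $C>0$, depending only on $N$, $p$ and $c_N$, such that the following holds. Let $0<s<1$, $0\le t\le s\le\gamma\le 1$ and $$\Gamma:=\frac{\gamma+t+sp}{p}.$$ Let $\Omega\subset\mathbb R^N$ be open, let $B_r\Subset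 B_R\Subset\Omega$ be concentric balls, $0<r<R$, and let $$0<h_0<\tfrac14\min\{\operatorname{dist}(B_R,\partial\Omega),\,R-r,\,1\}.$$ Let $\eta\in C^2(\mathbb R^N)$ satisfy $0\le\eta\le1$, $\eta\equiv1$ on $B_r$, $\eta\equiv0$ on $\mathbb R^N\setminus B_{(R+r)/2}$, $|\nabla\eta|\le\frac{c_N}{R-r}$ and $|D^2\eta|\le\frac{c_N}{(R-r)^2}$. Let $u:\mathbb R^N\to\mathbb R$ belong to $L^p_{loc}(\Omega)$, assume that $$\mathcal M_\gamma:=\sup_{0<|h|<h_0}\left[\frac{\delta_h(u\eta)}{|h|^{(\gamma+t)/p}}\right]^p_{W^{s,p}(B_R)}<+\infty,$$ and set $\mathcal E:=(1-s)\,\mathcal M_\gamma+h_0^{-\Gamma p}\,\|u\|^p_{L^p(B_{R+h_0})}$. Then $u\eta\in\mathcal B^{\Gamma,p}_\infty(\mathbb R^N)$ and $$[u\eta]^p_{\mathcal B^{\Gamma,p}_\infty(\mathbb R^N)}\le\frac Cs\left(\frac Rr\right)^N\left(\frac R{h_0}\right)^{1+p}\mathcal E.$$ Moreover: * if $\Gamma<1$,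 $$\sup_{0<|h|<h_0}\left\|\frac{\delta_hu}{|h|^\Gamma}\right\|^p_{L^p(B_r)}\le\frac{C}{s\,(1-\Gamma)^p}\left(\frac Rr\right)^N\left(\frac R{h_0}\right)^{1+p}\mathcal E<\infty;$$ * if $\Gamma=1$, for every $0<\tau<1$, $$\sup_{0<|h|<h_0}\left\|\frac{\delta_hu}{|h|^\tau}\right\|^p_{L^p(B_r)}\le\frac{C}{(1-\tau)^p}\left(\frac Rr\right)^N\left(\frac R{h_0}\right)^{1+p}\mathcal E<\infty;$$ * if $\Gamma>1$, then $u$ has a weak gradient $\nabla u\in L^p(B_r)$ on $B_r$, with $$\|\nabla u\|^p_{L^p(B_r)}\le\frac{C}{(\Gamma-1)^p}\left(\frac Rr\right)^N\left(\frac R{h_0}\right)^{1+p}\mathcal E,$$ and for every $0<\tau<\Gamma-1$ one has $\nabla u\in W^{\tau,p}(B_r)$ with $$[\nabla u]^p_{W^{\tau,p}(B_r)}\le\frac{C\,(R/r)^N}{(\Gamma-1-\tau)\,\tau}\left(\frac R{h_0}\right)^{1+p}\left(\frac{h_0^{-\tau}}{(2-\Gamma)(\Gamma-1)}\right)^p\mathcal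 E.$$ -/

import Mathlib

open MeasureTheory Metric Set
open scoped ENNReal ContDiff

noncomputable section

/-- `ℝ^N` with its Euclidean norm. -/
abbrev RN (N : ℕ) : Type := EuclideanSpace ℝ (Fin N)

/-- First order difference `δ_h ψ (x) = ψ (x + h) - ψ (x)`. -/
def fdiff {N : ℕ} (h : RN N) (ψ : RN N → ℝ) : RN N → ℝ :=
  fun x => ψ (x + h) - ψ x

/-- Second order difference `δ_h² ψ = δ_h (δ_h ψ)`. -/
def fdiff2 {N : ℕ} (h : RN N) (ψ : RN N → ℝ) : RN N → ℝ :=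
  fdiff h (fdiff h ψ)

/-- The norm of `ψ` in `L^p(A)`, as an extended nonnegative number. -/
def lpNormOn {N : ℕ} {F : Type*} [NormedAddCommGroup F] (p : ℝ) (ψ : RN N → F)
    (A : Set (RN N)) : ℝ≥0∞ :=
  eLpNorm ψ (ENNReal.ofReal p) (volume.restrict A)

/-- `ψ ∈ L^p(A)`. -/
def MemLpOn {N : ℕ} {F : Type*} [NormedAddCommGroup F] (p : ℝ) (ψ : RN N → F)
    (A : Set (RN N)) : Prop :=
  MemLp ψ (ENNReal.ofReal p) (volume.restrict A)

/-- `ψ ∈ L^p_loc(Ω)`. -/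
def MemLpLoc {N : ℕ} (p : ℝ) (ψ : RN N → ℝ) (Ω : Set (RN N)) : Prop :=
  ∀ K : Set (RN N), IsCompact K → K ⊆ Ω → MemLpOn p ψ K

/-- The Gagliardo seminorm `[ψ]_{W^{α,p}(A)}`, as an extended nonnegative number.  The integrand
vanishes on the diagonal, where it reads `0 / 0 = 0`. -/
def gagliardo {N : ℕ} {F : Type*} [NormedAddCommGroup F] (α p : ℝ) (ψ : RN N → F)
    (A : Set (RN N)) : ℝ≥0∞ :=
  (∫⁻ x in A, ∫⁻ y in A, ‖ψ x - ψ y‖ₑ ^ p / ‖x - y‖ₑ ^ ((N : ℝ) + α * p)) ^ (1 / p)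

/-- `ψ ∈ W^{α,p}(A)`, for `0 < α < 1`. -/
def MemFracSobolev {N : ℕ} {F : Type*} [NormedAddCommGroup F] (α p : ℝ) (ψ : RN N → F)
    (A : Set (RN N)) : Prop :=
  MemLpOn p ψ A ∧ gagliardo α p ψ A < ⊤

/-- The Nikol'skii seminorm `sup_{0 < |h| < h₀} ‖δ_h ψ / |h|^θ‖_{L^p(A)}`. -/
def nikolskii {N : ℕ} (θ p h₀ : ℝ) (ψ : RN N → ℝ) (A : Set (RN N)) : ℝ≥0∞ :=
  ⨆ (h : RN N) (_ : 0 < ‖h‖ ∧ ‖h‖ < h₀), lpNormOn p (fun x => fdiff h ψ x / ‖h‖ ^ θ) A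

/-- The seminorm `sup_{|h| > 0} ‖δ_h² ψ / |h|^α‖_{L^p(ℝ^N)}` of `B^{α,p}_∞(ℝ^N)`. -/
def besovSeminorm {N : ℕ} (α p : ℝ) (ψ : RN N → ℝ) : ℝ≥0∞ :=
  ⨆ (h : RN N) (_ : 0 < ‖h‖), lpNormOn p (fun x => fdiff2 h ψ x / ‖h‖ ^ α) univ

/-- `ψ ∈ B^{α,p}_∞(ℝ^N)`, for `0 < α < 2`. -/
def MemBesov {N : ℕ} (α p : ℝ) (ψ : RN N → ℝ) : Prop :=
  MemLpOn p ψ univ ∧ besovSeminorm α p ψ < ⊤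

/-- `G` is the weak (distributional) gradient of `ψ` in the open set `U`. -/
def IsWeakGradientOn {N : ℕ} (ψ : RN N → ℝ) (G : RN N → RN N) (U : Set (RN N)) : Prop :=
  LocallyIntegrableOn ψ U ∧ LocallyIntegrableOn G U ∧
    ∀ φ : RN N → ℝ, ContDiff ℝ ∞ φ → HasCompactSupport φ → tsupport φ ⊆ U →
      ∀ v : RN N, ∫ x in U, ψ x * fderiv ℝ φ x v = -∫ x in U, inner ℝ (G x) v * φ x

/-- The distance between two sets; it is `∞` if one of them is empty. -/
def setDist {N : ℕ} (A B : Set (RN N)) : ℝ≥0∞ :=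
  ⨅ x ∈ A, infEDist x B

/-- `η` is a `C²` cut-off function between the concentric balls `B_r(x₀)` and `B_R(x₀)`, with
constant `c` in the bounds for its first and second derivatives. -/
structure IsCutoff {N : ℕ} (c : ℝ) (x₀ : RN N) (r R : ℝ) (η : RN N → ℝ) : Prop where
  contDiff : ContDiff ℝ 2 η
  nonneg : ∀ x, 0 ≤ η x
  le_one : ∀ x, η x ≤ 1
  eq_one : ∀ x ∈ ball x₀ r, η x = 1
  eq_zero : ∀ x, x ∉ ball x₀ ((R + r) / 2) → η x = 0
  norm_fderiv_le : ∀ x, ‖fderiv ℝ η x‖ ≤ c / (R - r)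
  norm_fderiv2_le : ∀ x, ‖iteratedFDeriv ℝ 2 η x‖ ≤ c / (R - r) ^ 2

/-- `sup_{0 < |h| < h₀} [δ_h ψ / |h|^θ]_{W^{s,p}(A)}^p`. -/
def supGagliardo {N : ℕ} (θ s p h₀ : ℝ) (ψ : RN N → ℝ) (A : Set (RN N)) : ℝ≥0∞ :=
  ⨆ (h : RN N) (_ : 0 < ‖h‖ ∧ ‖h‖ < h₀),
    gagliardo s p (fun x => fdiff h ψ x / ‖h‖ ^ θ) A ^ p

end

/-! Write `v = u η` and `θ = (γ + t) / p`, so that `Γ = θ + s`. The heart of the matter is a bound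
for second differences, `‖δ_h² v‖_p ≤ k T |h|^Γ` for every `h`, where `T ^ p` is at most the energy.
For `|h| < h₀` it comes from applying to `f = δ_h v / |h|^θ`, with the same increment `h`, the
embedding of `W^{s,p}` into the Nikol'skii space of order `s`, with its factor `1 - s`
(`lintegral_fdiff_le`). The support of `v` is far enough from the boundary of `B_R` for the seminorm
over `B_R` to suffice. For `|h| ≥ h₀` the trivial bound `4 ‖v‖_p` is enough
(`eLpNorm_fdiff2_rpow_le`).

The factor `1 - s` arises because `k ↦ ‖δ_k f‖_p^p / |k|^{N + sp}` at `2k` is at most `2^{p(1-s) -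
N}` times its value at `k`. A dyadic annulus therefore carries at most the fraction `1 - 2^{-p(1-s)}
≤ p(1-s)` of the integral over the ball. Averaging the splitting `h = k + (h - k)` over a small ball
of `k` around `h/2` then bounds `δ_h f`.

Below order one, the identity `2 δ_h v = δ_{2h} v - δ_h² v` is iterated (`le_of_le_half_double`),
and the cut-off is removed on `B_r`, where `η = 1`.

Above order one, the same identity makes dyadic difference quotients a geometric Cauchy sequence in
`L^p`, whose limits are the weak partial derivatives. A mixed difference `δ_h δ_{be} v` is a
combination of two second differences, so the gradient inherits first differences of order `Γ - 1`
with no loss as `Γ → 2`. Integrating these against `|k|^{-N - τp}` gives the Gagliardo bound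
(`gagliardo_rpow_le`).

The argument loses none of the factors `1/s`, `R/r`, `R/h₀`, `1/(2 - Γ)`. All are at least one and
are inserted at the end. -/

/-! ### Elementary inequalities for dyadic iteration -/

/-- The convex function `2^{-x}` lies below its chord on `[0, 1]`. This turns the dyadic ratios met
below into the constants `1 / (1 - τ)` and `1 / (Γ - 1)`. -/
lemma half_mul_le_one_sub_two_rpow_neg {x : ℝ} (h0 : 0 ≤ x) (h1 : x ≤ 1) :
    x / 2 ≤ 1 - (2 : ℝ) ^ (-x) := by
  have h := rpow_one_add_le_one_add_mul_self (s := -1 / 2) (by norm_num) h0 h1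
  have e : (1 + -1 / 2 : ℝ) = 2⁻¹ := by norm_num
  rw [e, Real.inv_rpow (by norm_num), ← Real.rpow_neg (by norm_num)] at h
  linarith

/-- The exponential lies above its tangent and `log 2 ≤ 1`. Taken at `x = p (1 - s)`, this is the
origin of the factor `1 - s`. -/
lemma one_sub_two_rpow_neg_le {x : ℝ} (h0 : 0 ≤ x) : 1 - (2 : ℝ) ^ (-x) ≤ x := by
  have h := Real.add_one_le_exp (-x * Real.log 2)
  rw [Real.rpow_def_of_pos (by norm_num), mul_comm (Real.log 2)]
  have : Real.log 2 ≤ 1 := by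
    have := Real.log_two_lt_d9
    linarith
  nlinarith

/-- A bounded function `a` with `a(h) ≤ a(2h)/2 + K|h|^τ/2`, `τ < 1`, is `O(|h|^τ)`. -/
lemma le_of_le_half_double {N : ℕ} {a : RN N → ℝ} {A K τ : ℝ} (hA : ∀ h, a h ≤ A)
    (hK : 0 ≤ K) (hτ0 : 0 ≤ τ) (hτ : τ < 1)
    (ha : ∀ h, a h ≤ a ((2 : ℝ) • h) / 2 + K * ‖h‖ ^ τ / 2) (h : RN N) :
    a h ≤ K / (1 - τ) * ‖h‖ ^ τ := by
  set L := K / (1 - τ) with hL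
  have hL0 : 0 ≤ L := div_nonneg hK (by linarith)
  -- The profile `L |h|^τ` is a supersolution of the recursion, so only the a priori bound `A` is
  -- halved at each step, and it disappears in the limit.
  have hstep : (2 : ℝ) ^ τ * L / 2 + K / 2 ≤ L := by
    have h1 := half_mul_le_one_sub_two_rpow_neg (x := 1 - τ) (by linarith) (by linarith)
    have h2 : (2 : ℝ) ^ (-(1 - τ)) = 2 ^ τ / 2 := by
      rw [neg_sub, Real.rpow_sub (by norm_num), Real.rpow_one]
    rw [h2] at h1
    have h3 : K = L * (1 - τ) := by rw [hL, div_mul_cancel₀]; linarith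
    nlinarith [mul_le_mul_of_nonneg_left h1 hL0]
  have key : ∀ n : ℕ, ∀ h, a h ≤ (1 / 2) ^ n * A + L * ‖h‖ ^ τ := by
    intro n
    induction n with
    | zero =>
      intro h
      have : 0 ≤ L * ‖h‖ ^ τ := by positivity
      simpa using (hA h).trans (by linarith)
    | succ n ih =>
      intro h
      have h1 := ha h
      have h2 := ih ((2 : ℝ) • h)
      rw [norm_smul, Real.mul_rpow (by positivity) (by positivity)] at h2
      simp only [Real.norm_ofNat] at h2
      have h4 : 0 ≤ ‖h‖ ^ τ := by positivity
      have h5 := mul_le_mul_of_nonneg_right hstep h4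
      rw [pow_succ]
      nlinarith
  have lim : Filter.Tendsto (fun n : ℕ => (1 / 2 : ℝ) ^ n * A + L * ‖h‖ ^ τ) Filter.atTop
      (nhds (0 * A + L * ‖h‖ ^ τ)) :=
    ((tendsto_pow_atTop_nhds_zero_of_lt_one (by norm_num) (by norm_num)).mul_const A).add_const _
  simpa using ge_of_tendsto' lim (fun n => key n h)

/-! ### Algebra of translations and differences in `L^q` -/

section Differences

variable {N : ℕ}

lemma fdiff2_apply (h : RN N) (v : RN N → ℝ) (x : RN N) :
    fdiff2 h v x = v (x + h + h) - 2 * v (x + h) + v x := by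
  simp only [fdiff2, fdiff]; ring

/-- With `S` the translation by `h`, this is `S² - 1 = 2 (S - 1) + (S - 1)²`. -/
lemma fdiff_eq_half_double (h : RN N) (v : RN N → ℝ) :
    fdiff h v = (1 / 2 : ℝ) • (fdiff ((2 : ℝ) • h) v - fdiff2 h v) := by
  ext x
  simp only [Pi.smul_apply, Pi.sub_apply, fdiff2_apply, fdiff, two_smul, smul_eq_mul, add_assoc]
  ring

/-- Both second differences on the right are centred at `x + m`, so their middle terms cancel. This
makes mixed differences accessible to bounds on pure ones. -/
lemma fdiff_fdiff_eq (m d : RN N) (v : RN N → ℝ) :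
    fdiff (m + d) (fdiff (m - d) v) = fdiff2 m v - fun x => fdiff2 d v (x + (m - d)) := by
  ext x
  simp only [Pi.sub_apply, fdiff2_apply, fdiff]
  have e1 : x + (m + d) + (m - d) = x + m + m := by abel
  have e2 : x + (m - d) + d = x + m := by abel
  have e3 : x + m + d = x + (m + d) := by abel
  rw [e1, e2, e3]
  ring

variable {F : Type*} [NormedAddCommGroup F] {q : ℝ≥0∞}

lemma eLpNorm_comp_add_right {v : RN N → F} (hv : AEStronglyMeasurable v volume) (h : RN N) :
    eLpNorm (fun x => v (x + h)) q volume = eLpNorm v q volume :=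
  eLpNorm_comp_measurePreserving (g := v) hv (measurePreserving_add_right volume h)

lemma aestronglyMeasurable_comp_add_right {v : RN N → F} (hv : AEStronglyMeasurable v volume)
    (h : RN N) : AEStronglyMeasurable (fun x => v (x + h)) volume :=
  hv.comp_measurePreserving (measurePreserving_add_right volume h)

lemma memLp_comp_add_right {v : RN N → F} (hv : MemLp v q volume) (h : RN N) :
    MemLp (fun x => v (x + h)) q volume :=
  hv.comp_measurePreserving (measurePreserving_add_right volume h)

lemma MeasureTheory.MemLp.fdiff {v : RN N → ℝ} (hv : MemLp v q volume) (h : RN N) :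
    MemLp (fdiff h v) q volume :=
  (memLp_comp_add_right hv h).sub hv

lemma MeasureTheory.MemLp.fdiff2 {v : RN N → ℝ} (hv : MemLp v q volume) (h : RN N) :
    MemLp (fdiff2 h v) q volume :=
  (hv.fdiff h).fdiff h

lemma eLpNorm_sub_shift_le {v : RN N → F} (hv : AEStronglyMeasurable v volume) (hq : 1 ≤ q)
    (h : RN N) : eLpNorm (fun x => v (x + h) - v x) q volume ≤ 2 * eLpNorm v q volume := by
  refine (eLpNorm_sub_le (aestronglyMeasurable_comp_add_right hv h) hv hq).trans ?_
  rw [eLpNorm_comp_add_right hv, two_mul]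

lemma eLpNorm_fdiff_le {v : RN N → ℝ} (hv : AEStronglyMeasurable v volume) (hq : 1 ≤ q)
    (h : RN N) : eLpNorm (fdiff h v) q volume ≤ 2 * eLpNorm v q volume :=
  eLpNorm_sub_shift_le hv hq h

lemma eLpNorm_fdiff2_le {v : RN N → ℝ} (hv : MemLp v q volume) (hq : 1 ≤ q)
    (h : RN N) : eLpNorm (fdiff2 h v) q volume ≤ 4 * eLpNorm v q volume := by
  refine (eLpNorm_fdiff_le (hv.fdiff h).1 hq h).trans ?_
  grw [eLpNorm_fdiff_le hv.1 hq h]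
  rw [← mul_assoc]; norm_num

/-- Second differences of order `τ < 1` control first differences of order `τ`. -/
lemma eLpNorm_fdiff_le_of_fdiff2 {v : RN N → ℝ} (hv : MemLp v q volume) (hq : 1 ≤ q)
    {K τ : ℝ} (hK : 0 ≤ K) (hτ0 : 0 ≤ τ) (hτ : τ < 1)
    (h2 : ∀ h, eLpNorm (fdiff2 h v) q volume ≤ ENNReal.ofReal (K * ‖h‖ ^ τ)) (h : RN N) :
    eLpNorm (fdiff h v) q volume ≤ ENNReal.ofReal (K / (1 - τ) * ‖h‖ ^ τ) := by
  have hfin : ∀ h, eLpNorm (fdiff h v) q volume ≠ ⊤ := fun h => (hv.fdiff h).2.ne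
  rw [← ENNReal.ofReal_toReal (hfin h)]
  refine ENNReal.ofReal_le_ofReal ?_
  refine le_of_le_half_double (a := fun h => (eLpNorm (fdiff h v) q volume).toReal)
    (A := (2 * eLpNorm v q volume).toReal) (fun h => ?_) hK hτ0 hτ (fun h => ?_) h
  · exact ENNReal.toReal_mono (ENNReal.mul_ne_top (by simp) hv.2.ne) (eLpNorm_fdiff_le hv.1 hq h)
  · have e := fdiff_eq_half_double h v
    have h3 : eLpNorm (fdiff h v) q volume ≤ 2⁻¹ * (eLpNorm (fdiff ((2 : ℝ) • h) v) q volume +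
        ENNReal.ofReal (K * ‖h‖ ^ τ)) := by
      conv_lhs => rw [e]
      rw [eLpNorm_const_smul]
      have : ‖(1 / 2 : ℝ)‖ₑ = 2⁻¹ := by
        rw [Real.enorm_eq_ofReal (by norm_num), one_div, ENNReal.ofReal_inv_of_pos (by norm_num)]
        simp
      rw [this]
      gcongr
      refine (eLpNorm_sub_le (hv.fdiff _).1 (hv.fdiff2 _).1 hq).trans ?_
      gcongr
      exact h2 h
    have hne : (2⁻¹ * (eLpNorm (fdiff ((2 : ℝ) • h) v) q volume +
        ENNReal.ofReal (K * ‖h‖ ^ τ))) ≠ ⊤ :=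
      ENNReal.mul_ne_top (by simp) (ENNReal.add_ne_top.2 ⟨hfin _, by simp⟩)
    have h4 := ENNReal.toReal_mono hne h3
    rw [ENNReal.toReal_mul, ENNReal.toReal_add (hfin _) (by simp), ENNReal.toReal_ofReal
      (by positivity)] at h4
    simp only [ENNReal.toReal_inv, ENNReal.toReal_ofNat] at h4
    linarith

end Differences

lemma eLpNorm_ofReal_rpow {α F : Type*} [MeasurableSpace α] [NormedAddCommGroup F] {p : ℝ}
    (hp : 0 < p) (f : α → F) (μ : Measure α) :
    eLpNorm f (ENNReal.ofReal p) μ ^ p = ∫⁻ x, ‖f x‖ₑ ^ p ∂μ := by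
  rw [eLpNorm_eq_lintegral_rpow_enorm_toReal (by simpa using hp) (by simp),
    ENNReal.toReal_ofReal hp.le, ← ENNReal.rpow_mul, one_div, inv_mul_cancel₀ hp.ne',
    ENNReal.rpow_one]

/-! ### Mass of an almost homogeneous function on a dyadic annulus -/

section Averaging

variable {N : ℕ}

lemma lintegral_comp_two_smul {Φ : RN N → ℝ≥0∞} (hΦ : Measurable Φ) :
    ∫⁻ k, Φ k = ENNReal.ofReal (2 ^ N) * ∫⁻ k, Φ ((2 : ℝ) • k) := by
  have h := Measure.map_addHaar_smul (volume : Measure (RN N)) (r := 2) (by norm_num)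
  have h2 : ∫⁻ k, Φ ((2 : ℝ) • k) = ∫⁻ k, Φ k ∂(Measure.map ((2 : ℝ) • ·) volume) :=
    (lintegral_map hΦ (measurable_const_smul _)).symm
  rw [h2, h, lintegral_smul_measure, smul_eq_mul, ← mul_assoc, ← ENNReal.ofReal_mul (by positivity)]
  rw [finrank_euclideanSpace_fin, abs_of_pos (by positivity), mul_inv_cancel₀ (by positivity)]
  simp

/-- If `Φ` is almost homogeneous of degree `θ - N`, its integral over an annulus is at most `θ`
times its integral over the ball. -/
lemma lintegral_annulus_le {Φ : RN N → ℝ≥0∞} (hΦ : Measurable Φ) {ρ θ : ℝ} (hθ : 0 ≤ θ)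
    (h2 : ∀ k, Φ ((2 : ℝ) • k) ≤ ENNReal.ofReal (2 ^ (θ - N)) * Φ k)
    (hfin : ∫⁻ k in closedBall 0 ρ, Φ k ≠ ⊤) :
    ∫⁻ k in closedBall 0 ρ \ closedBall 0 (ρ / 2), Φ k ≤
      ENNReal.ofReal θ * ∫⁻ k in closedBall 0 ρ, Φ k := by
  rcases lt_or_ge ρ 0 with hρ | hρ
  · simp [closedBall_eq_empty.2 hρ]
  have hsub : closedBall (0 : RN N) (ρ / 2) ⊆ closedBall 0 ρ := closedBall_subset_closedBall (by linarith)
  have hsplit : ∫⁻ k in closedBall 0 ρ, Φ k = (∫⁻ k in closedBall 0 (ρ / 2), Φ k) +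
      ∫⁻ k in closedBall 0 ρ \ closedBall 0 (ρ / 2), Φ k := by
    rw [← lintegral_union (measurableSet_closedBall.diff measurableSet_closedBall)
      disjoint_sdiff_right, union_sdiff_cancel hsub]
  -- Substituting `2k` for `k`, the Jacobian `2^N` cancels the `2^{-N}` in the homogeneity bound.
  have hscale : ∫⁻ k in closedBall 0 ρ, Φ k ≤
      ENNReal.ofReal (2 ^ θ) * ∫⁻ k in closedBall 0 (ρ / 2), Φ k := by
    rw [← lintegral_indicator measurableSet_closedBall, lintegral_comp_two_smul
      (hΦ.indicator measurableSet_closedBall), ← lintegral_indicator measurableSet_closedBall,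
      Real.rpow_sub (by norm_num), Real.rpow_natCast] at *
    calc _ ≤ ENNReal.ofReal (2 ^ N) * ∫⁻ k, ENNReal.ofReal (2 ^ θ / 2 ^ N) *
          (closedBall (0 : RN N) (ρ / 2)).indicator Φ k := by
            gcongr with k
            by_cases hk : (2 : ℝ) • k ∈ closedBall (0 : RN N) ρ
            · have hk' : k ∈ closedBall (0 : RN N) (ρ / 2) := by
                simp only [mem_closedBall, dist_zero_right, norm_smul, Real.norm_ofNat] at hk ⊢
                linarith
              rw [indicator_of_mem hk, indicator_of_mem hk']
              exact h2 k
            · rw [indicator_of_notMem hk]; simp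
      _ = _ := by
        rw [lintegral_const_mul _ (hΦ.indicator measurableSet_closedBall), ← mul_assoc,
          ← ENNReal.ofReal_mul (by positivity), mul_div_cancel₀ _ (by positivity)]
  set I := ∫⁻ k in closedBall 0 ρ, Φ k with hI
  set I' := ∫⁻ k in closedBall 0 (ρ / 2), Φ k with hI'
  set J := ∫⁻ k in closedBall 0 ρ \ closedBall 0 (ρ / 2), Φ k with hJ
  have hI'f : I' ≠ ⊤ := ne_top_of_le_ne_top hfin (hsplit ▸ le_self_add)
  have hJf : J ≠ ⊤ := ne_top_of_le_ne_top hfin (hsplit ▸ le_add_self)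
  have e1 := congrArg ENNReal.toReal hsplit
  rw [ENNReal.toReal_add hI'f hJf] at e1
  have e2 := ENNReal.toReal_mono (ENNReal.mul_ne_top (by simp) hI'f) hscale
  rw [ENNReal.toReal_mul, ENNReal.toReal_ofReal (by positivity)] at e2
  rw [← ENNReal.ofReal_toReal hJf, ← ENNReal.ofReal_toReal hfin, ← ENNReal.ofReal_mul hθ]
  refine ENNReal.ofReal_le_ofReal ?_
  have e3 := one_sub_two_rpow_neg_le hθ
  have e4 : (2 : ℝ) ^ (-θ) * 2 ^ θ = 1 := by
    rw [← Real.rpow_add (by norm_num)]; simp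
  -- The inner ball keeps the fraction `2^{-θ}` of the mass, so the annulus has at most `1 - 2^{-θ}`
  -- of it. The subtraction needs finite integrals, hence the passage to reals.
  have e5 : (2 : ℝ) ^ (-θ) * I.toReal ≤ I'.toReal := by
    calc _ ≤ (2 : ℝ) ^ (-θ) * (2 ^ θ * I'.toReal) := by gcongr
      _ = _ := by rw [← mul_assoc, e4, one_mul]
  have e6 := mul_le_mul_of_nonneg_right e3 (ENNReal.toReal_nonneg (a := I))
  linarith

end Averaging

/-! ### From the Gagliardo seminorm to first differences, with the factor `1 - s` -/

section NikolskiiGagliardo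

variable {N : ℕ} {p : ℝ} {f : RN N → ℝ}

lemma fdiff_add_eq (h k : RN N) (f : RN N → ℝ) :
    fdiff (h + k) f = (fun x => fdiff h f (x + k)) + fdiff k f := by
  ext x
  simp only [fdiff, Pi.add_apply]
  rw [add_assoc x k h, add_comm k h]; ring

lemma aestronglyMeasurable_fdiff (hf : AEStronglyMeasurable f volume) (h : RN N) :
    AEStronglyMeasurable (fdiff h f) volume :=
  (aestronglyMeasurable_comp_add_right hf h).sub hf

lemma eLpNorm_fdiff_add_le {q : ℝ≥0∞} (hq : 1 ≤ q) (hf : AEStronglyMeasurable f volume)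
    (h k : RN N) :
    eLpNorm (fdiff (h + k) f) q volume ≤
      eLpNorm (fdiff h f) q volume + eLpNorm (fdiff k f) q volume := by
  rw [fdiff_add_eq]
  refine (eLpNorm_add_le (aestronglyMeasurable_comp_add_right (aestronglyMeasurable_fdiff hf h) k)
    (aestronglyMeasurable_fdiff hf k) hq).trans ?_
  rw [eLpNorm_comp_add_right (aestronglyMeasurable_fdiff hf h)]

lemma lintegral_fdiff_two_smul_le (hp : 1 ≤ p) (hf : AEStronglyMeasurable f volume) (k : RN N) :
    ∫⁻ x, ‖fdiff ((2 : ℝ) • k) f x‖ₑ ^ p ≤ ENNReal.ofReal (2 ^ p) * ∫⁻ x, ‖fdiff k f x‖ₑ ^ p := by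
  have hp0 : 0 < p := by linarith
  rw [← eLpNorm_ofReal_rpow hp0, ← eLpNorm_ofReal_rpow hp0, ← ENNReal.ofReal_rpow_of_pos (by norm_num),
    ← ENNReal.mul_rpow_of_nonneg _ _ hp0.le, two_smul]
  gcongr
  refine (eLpNorm_fdiff_add_le (by simpa using hp) hf k k).trans ?_
  rw [← two_mul]; simp

lemma lintegral_fdiff_le_add (hp : 1 ≤ p) (hf : AEStronglyMeasurable f volume) (h k : RN N) :
    ∫⁻ x, ‖fdiff h f x‖ₑ ^ p ≤ ENNReal.ofReal (2 ^ (p - 1)) *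
      ((∫⁻ x, ‖fdiff k f x‖ₑ ^ p) + ∫⁻ x, ‖fdiff (h - k) f x‖ₑ ^ p) := by
  have hp0 : 0 < p := by linarith
  simp only [← eLpNorm_ofReal_rpow hp0]
  have h1 := eLpNorm_fdiff_add_le (q := ENNReal.ofReal p) (by simpa using hp) hf k (h - k)
  rw [add_sub_cancel] at h1
  calc _ ≤ (eLpNorm (fdiff k f) (ENNReal.ofReal p) volume +
        eLpNorm (fdiff (h - k) f) (ENNReal.ofReal p) volume) ^ p := by gcongr
    _ ≤ _ := by
      refine (ENNReal.rpow_add_le_mul_rpow_add_rpow _ _ hp).trans ?_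
      rw [← ENNReal.ofReal_rpow_of_pos (by norm_num)]; simp

lemma measurable_lintegral_fdiff (hf : Measurable f) :
    Measurable fun k : RN N => ∫⁻ x, ‖fdiff k f x‖ₑ ^ p := by
  unfold fdiff
  refine Measurable.lintegral_prod_right' (f := fun z : RN N × RN N => ‖f (z.2 + z.1) - f z.2‖ₑ ^ p) ?_
  fun_prop

/-- Substitute `y = x + k` and use Tonelli. Where `δ_k f` is nonzero, one of `x`, `x + k` lies in
the ball of radius `ρ₀` and the other within `ρ` of it, so the double integral over the larger ball
sees the whole-space norm of `δ_k f`. -/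
lemma lintegral_fdiff_div_le_gagliardo (hp : 0 < p) (hf : Measurable f) {q ρ₀ ρ R : ℝ}
    {x₀ : RN N} (h0 : ∀ x, x ∉ ball x₀ ρ₀ → f x = 0) (hR : ρ₀ + ρ ≤ R) (hρ : 0 ≤ ρ) :
    ∫⁻ k in closedBall 0 ρ, (∫⁻ x, ‖fdiff k f x‖ₑ ^ p) / ‖k‖ₑ ^ q ≤
      ∫⁻ x in ball x₀ R, ∫⁻ y in ball x₀ R, ‖f x - f y‖ₑ ^ p / ‖x - y‖ₑ ^ q := by
  set S := ball x₀ R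
  set Fn : RN N → RN N → ℝ≥0∞ := fun x y =>
    S.indicator (fun _ => S.indicator (fun y => ‖f x - f y‖ₑ ^ p / ‖x - y‖ₑ ^ q) y) x with hFn
  have hFm : Measurable (Function.uncurry Fn) := by
    have : Function.uncurry Fn = (S ×ˢ S).indicator
        (fun z => ‖f z.1 - f z.2‖ₑ ^ p / ‖z.1 - z.2‖ₑ ^ q) := by
      ext ⟨x, y⟩
      by_cases hx : x ∈ S <;> by_cases hy : y ∈ S <;> simp [hFn, Function.uncurry, hx, hy]
    rw [this]
    refine Measurable.indicator ?_ (measurableSet_ball.prod measurableSet_ball)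
    fun_prop
  have hRHS : ∫⁻ x in S, ∫⁻ y in S, ‖f x - f y‖ₑ ^ p / ‖x - y‖ₑ ^ q = ∫⁻ x, ∫⁻ y, Fn x y := by
    rw [← lintegral_indicator measurableSet_ball]
    refine lintegral_congr fun x => ?_
    by_cases hx : x ∈ S
    · rw [indicator_of_mem hx, ← lintegral_indicator measurableSet_ball]
      simp only [hFn, indicator_of_mem hx]
      rfl
    · rw [indicator_of_notMem hx]
      simp only [hFn, indicator_of_notMem hx, lintegral_zero]
  rw [hRHS]
  calc _ ≤ ∫⁻ k in closedBall 0 ρ, ∫⁻ x, Fn x (x + k) := by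
        refine setLIntegral_mono' measurableSet_closedBall fun k hk => ?_
        rw [div_eq_mul_inv, ← lintegral_mul_const _ (by unfold fdiff; fun_prop)]
        refine lintegral_mono fun x => ?_
        have hk' : ‖k‖ ≤ ρ := by simpa using hk
        by_cases hx : x ∈ S ∧ x + k ∈ S
        · simp only [hFn, indicator_of_mem hx.1, indicator_of_mem hx.2, fdiff, div_eq_mul_inv]
          rw [enorm_sub_rev, sub_add_cancel_left, enorm_neg]
        · have : fdiff k f x = 0 := by
            have d : dist (x + k) x = ‖k‖ := by simp
            by_cases h1 : x ∈ ball x₀ ρ₀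
            · refine absurd ⟨?_, ?_⟩ hx
              · simp only [S, mem_ball] at h1 ⊢; linarith
              · have := dist_triangle (x + k) x x₀
                simp only [S, mem_ball] at h1 ⊢; linarith
            · by_cases h2 : x + k ∈ ball x₀ ρ₀
              · refine absurd ⟨?_, ?_⟩ hx
                · have := dist_triangle x (x + k) x₀
                  rw [dist_comm x (x + k)] at this
                  simp only [S, mem_ball] at h2 ⊢; linarith
                · simp only [S, mem_ball] at h2 ⊢; linarith
              · simp [fdiff, h0 _ h1, h0 _ h2]
          simp [this, hp]
    _ ≤ ∫⁻ k, ∫⁻ x, Fn x (x + k) := setLIntegral_le_lintegral _ _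
    _ = ∫⁻ x, ∫⁻ k, Fn x (x + k) := by
        refine lintegral_lintegral_swap ?_
        have : Measurable fun z : RN N × RN N => Function.uncurry Fn (z.2, z.2 + z.1) :=
          hFm.comp (by fun_prop)
        exact this.aemeasurable
    _ = _ := by
        refine lintegral_congr fun x => ?_
        exact lintegral_add_left_eq_self (Fn x) x

/-- The constant in the embedding of `W^{s,p}` into the Nikol'skii space. -/
noncomputable def nikolskiiConst (N : ℕ) (p : ℝ) : ℝ :=
  2 ^ p * p * 8 ^ N / (volume (ball (0 : RN N) 1)).toReal

lemma volume_unitBall_pos : 0 < (volume (ball (0 : RN N) 1)).toReal :=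
  ENNReal.toReal_pos (measure_ball_pos _ _ one_pos).ne' measure_ball_lt_top.ne

lemma nikolskiiConst_pos (hp : 0 < p) : 0 < nikolskiiConst N p := by
  have := volume_unitBall_pos (N := N)
  unfold nikolskiiConst; positivity

/-- Averaging `δ_h f`, split through `k` and `h - k`, over `k` near `h / 2` leaves an integral of
`‖δ_k f‖_p^p` over a dyadic annulus. Subadditivity in `k` gives the scaling needed to bound that
annulus by `p (1 - s)` times the ball. -/
lemma lintegral_fdiff_le_of_measurable (hN : 1 ≤ N) (hp : 1 ≤ p) (hf : Measurable f)
    {s ρ₀ R : ℝ} (hs0 : 0 < s)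
    (hs1 : s < 1) {x₀ h : RN N} (h0 : ∀ x, x ∉ ball x₀ ρ₀ → f x = 0) (hh : h ≠ 0)
    (hR : ρ₀ + ‖h‖ ≤ R)
    (hfin : ∫⁻ x in ball x₀ R, ∫⁻ y in ball x₀ R, ‖f x - f y‖ₑ ^ p /
      ‖x - y‖ₑ ^ (N + s * p) ≠ ⊤) :
    ∫⁻ x, ‖fdiff h f x‖ₑ ^ p ≤ ENNReal.ofReal (nikolskiiConst N p * (1 - s) * ‖h‖ ^ (s * p)) *
      ∫⁻ x in ball x₀ R, ∫⁻ y in ball x₀ R, ‖f x - f y‖ₑ ^ p / ‖x - y‖ₑ ^ (N + s * p) := by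
  have hp0 : 0 < p := by linarith
  have hn : 0 < ‖h‖ := norm_pos_iff.2 hh
  set q : ℝ := N + s * p with hq
  have hq0 : 0 < q := by positivity
  set I₀ := ∫⁻ x in ball x₀ R, ∫⁻ y in ball x₀ R, ‖f x - f y‖ₑ ^ p / ‖x - y‖ₑ ^ q
  set G : RN N → ℝ≥0∞ := fun k => ∫⁻ x, ‖fdiff k f x‖ₑ ^ p with hG
  have hGm : Measurable G := measurable_lintegral_fdiff hf
  set Φ : RN N → ℝ≥0∞ := fun k => G k / ‖k‖ₑ ^ q with hΦ
  have hΦm : Measurable Φ := hGm.div (by fun_prop)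
  -- The annulus `3/8 |h| < |k| ≤ 3/4 |h|` contains the averaging ball `D`, whose points have norm
  -- between `3/8 |h|` and `5/8 |h|`. Keeping `ρ < |h|` lets the support condition apply.
  set ρ := 3 / 4 * ‖h‖ with hρ
  have hI : ∫⁻ k in closedBall 0 ρ, Φ k ≤ I₀ :=
    lintegral_fdiff_div_le_gagliardo hp0 hf h0 (by linarith) (by positivity)
  have hθ : 0 ≤ p * (1 - s) := mul_nonneg hp0.le (by linarith)
  have hhom : ∀ k, Φ ((2 : ℝ) • k) ≤ ENNReal.ofReal (2 ^ (p * (1 - s) - N)) * Φ k := by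
    intro k
    simp only [hΦ, hG]
    rw [enorm_smul, ENNReal.mul_rpow_of_nonneg _ _ hq0.le]
    have e : p * (1 - s) - N = p - q := by rw [hq]; ring
    have e2 : ‖(2 : ℝ)‖ₑ ^ q = ENNReal.ofReal (2 ^ q) := by
      rw [Real.enorm_eq_ofReal (by norm_num), ENNReal.ofReal_rpow_of_pos (by norm_num)]
    rw [e, Real.rpow_sub (by norm_num), e2, ENNReal.ofReal_div_of_pos (by positivity)]
    rw [div_eq_mul_inv, ENNReal.mul_inv (by left; simp; positivity) (by left; simp), div_eq_mul_inv,
      div_eq_mul_inv]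
    grw [lintegral_fdiff_two_smul_le hp hf.aestronglyMeasurable k]
    apply le_of_eq; ring
  have hJ := lintegral_annulus_le hΦm hθ hhom (ne_top_of_le_ne_top hfin hI)
  set A := closedBall (0 : RN N) ρ \ closedBall 0 (ρ / 2) with hA
  have hAm : MeasurableSet A := measurableSet_closedBall.diff measurableSet_closedBall
  set D := ball ((1 / 2 : ℝ) • h) (‖h‖ / 8) with hD
  have hDA : D ⊆ A := by
    intro k hk
    have hk' : ‖k - (1 / 2 : ℝ) • h‖ < ‖h‖ / 8 := by simpa [hD, dist_eq_norm] using hk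
    have hh2 : ‖(1 / 2 : ℝ) • h‖ = ‖h‖ / 2 := by rw [norm_smul]; norm_num; ring
    have t1 := norm_sub_norm_le k ((1 / 2 : ℝ) • h)
    have t2 := norm_sub_norm_le ((1 / 2 : ℝ) • h) k
    rw [norm_sub_rev] at t2
    simp only [hA, mem_sdiff, mem_closedBall, dist_zero_right, not_le, hρ]
    constructor <;> linarith
  -- `D` is centred at `h / 2`, hence invariant under `k ↦ h - k`.
  have hsymm : ∫⁻ k in D, G (h - k) = ∫⁻ k in D, G k := by
    rw [← lintegral_indicator measurableSet_ball, ← lintegral_indicator measurableSet_ball,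
      ← lintegral_sub_left_eq_self _ h]
    refine lintegral_congr fun k => ?_
    have : k ∈ D ↔ h - k ∈ D := by
      simp only [hD, mem_ball, dist_eq_norm]
      have : h - k - (1 / 2 : ℝ) • h = -(k - (1 / 2 : ℝ) • h) := by
        have : h = (1 / 2 : ℝ) • h + (1 / 2 : ℝ) • h := by rw [← add_smul]; norm_num
        nth_rw 1 [this]; abel
      rw [this, norm_neg]
    by_cases hk : k ∈ D
    · rw [indicator_of_mem hk, indicator_of_mem (this.1 hk), sub_sub_cancel]
    · rw [indicator_of_notMem hk, indicator_of_notMem (fun hc => hk (this.2 hc))]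
  have havg : volume D * G h ≤ ENNReal.ofReal (2 ^ p) * ∫⁻ k in D, G k := by
    calc volume D * G h = ∫⁻ _ in D, G h := by rw [lintegral_const]; simp [mul_comm]
      _ ≤ ∫⁻ k in D, ENNReal.ofReal (2 ^ (p - 1)) * (G k + G (h - k)) :=
        lintegral_mono fun k => lintegral_fdiff_le_add hp hf.aestronglyMeasurable h k
      _ = ENNReal.ofReal (2 ^ p) * ∫⁻ k in D, G k := by
        rw [lintegral_const_mul' _ _ (by simp), lintegral_add_left hGm, hsymm, ← two_mul,
          ← mul_assoc, Real.rpow_sub (by norm_num)]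
        congr 1
        rw [← ENNReal.ofReal_ofNat 2, ← ENNReal.ofReal_mul (by positivity)]
        congr 1
        simp
  have hGA : ∫⁻ k in D, G k ≤ ENNReal.ofReal (‖h‖ ^ q) * ∫⁻ k in A, Φ k := by
    refine (lintegral_mono_set hDA).trans ?_
    rw [← lintegral_const_mul _ hΦm]
    refine setLIntegral_mono' hAm fun k hk => ?_
    simp only [hA, mem_sdiff, mem_closedBall, dist_zero_right, not_le] at hk
    have hkpos : 0 < ‖k‖ := lt_of_le_of_lt (by positivity) hk.2
    have e : ‖k‖ₑ ^ q = ENNReal.ofReal (‖k‖ ^ q) := by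
      rw [← ofReal_norm, ENNReal.ofReal_rpow_of_pos hkpos]
    simp only [hΦ]
    rw [e, ← mul_div_assoc, ENNReal.le_div_iff_mul_le (by left; simp; positivity) (by left; simp),
      mul_comm]
    gcongr
    linarith
  have hvol : volume D = ENNReal.ofReal (‖h‖ ^ N / 8 ^ N * (volume (ball (0 : RN N) 1)).toReal) := by
    rw [hD, Measure.addHaar_ball_of_pos _ _ (by positivity), finrank_euclideanSpace_fin,
      ENNReal.ofReal_mul (by positivity), ENNReal.ofReal_toReal measure_ball_lt_top.ne, div_pow]
  have hw := volume_unitBall_pos (N := N)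
  set w := (volume (ball (0 : RN N) 1)).toReal
  have hfinal : ENNReal.ofReal (‖h‖ ^ N / 8 ^ N * w) * G h ≤
      ENNReal.ofReal (‖h‖ ^ N / 8 ^ N * w) *
        (ENNReal.ofReal (nikolskiiConst N p * (1 - s) * ‖h‖ ^ (s * p)) * I₀) := by
    rw [← hvol]
    grw [havg, hGA, hJ, hI, hvol]
    simp only [← mul_assoc]
    rw [← ENNReal.ofReal_mul (by positivity), ← ENNReal.ofReal_mul (by positivity),
      ← ENNReal.ofReal_mul (by positivity)]
    apply le_of_eq
    congr 2
    rw [nikolskiiConst, hq, Real.rpow_add hn, Real.rpow_natCast]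
    have hwd : (volume (ball (0 : RN N) 1)).toReal = w := rfl
    rw [hwd]
    field_simp
  refine (ENNReal.mul_le_mul_iff_right ?_ (by simp)).1 hfinal
  simp; positivity

/-- A function of `W^{s,p}` supported well inside `ball x₀ R` has first differences of order `s`
in `L^p`, with the factor `1 - s` of Bourgain, Brezis and Mironescu. -/
lemma lintegral_fdiff_le (hN : 1 ≤ N) (hp : 1 ≤ p) (hf : AEStronglyMeasurable f volume)
    {s ρ₀ R : ℝ} (hs0 : 0 < s)
    (hs1 : s < 1) {x₀ h : RN N} (h0 : ∀ x, x ∉ ball x₀ ρ₀ → f x = 0) (hh : h ≠ 0)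
    (hR : ρ₀ + ‖h‖ ≤ R)
    (hfin : ∫⁻ x in ball x₀ R, ∫⁻ y in ball x₀ R, ‖f x - f y‖ₑ ^ p /
      ‖x - y‖ₑ ^ (N + s * p) ≠ ⊤) :
    ∫⁻ x, ‖fdiff h f x‖ₑ ^ p ≤ ENNReal.ofReal (nikolskiiConst N p * (1 - s) * ‖h‖ ^ (s * p)) *
      ∫⁻ x in ball x₀ R, ∫⁻ y in ball x₀ R, ‖f x - f y‖ₑ ^ p / ‖x - y‖ₑ ^ (N + s * p) := by
  -- The indicator makes the measurable representative vanish everywhere outside the ball, not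
  -- merely almost everywhere.
  set g := (ball x₀ ρ₀).indicator (hf.mk f) with hg
  have hgm : Measurable g := hf.stronglyMeasurable_mk.measurable.indicator measurableSet_ball
  have hfg : f =ᵐ[volume] g := by
    filter_upwards [hf.ae_eq_mk] with x hx
    by_cases hx0 : x ∈ ball x₀ ρ₀
    · rw [hg, indicator_of_mem hx0, hx]
    · rw [hg, indicator_of_notMem hx0, h0 x hx0]
  have e1 : ∫⁻ x, ‖fdiff h f x‖ₑ ^ p = ∫⁻ x, ‖fdiff h g x‖ₑ ^ p := by
    refine lintegral_congr_ae ?_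
    filter_upwards [hfg, (measurePreserving_add_right volume h).quasiMeasurePreserving.ae_eq_comp hfg]
      with x hx hx'
    simp only [Function.comp_apply] at hx'
    simp only [fdiff, hx, hx']
  have e2 : ∫⁻ x in ball x₀ R, ∫⁻ y in ball x₀ R, ‖f x - f y‖ₑ ^ p / ‖x - y‖ₑ ^ (N + s * p) =
      ∫⁻ x in ball x₀ R, ∫⁻ y in ball x₀ R, ‖g x - g y‖ₑ ^ p / ‖x - y‖ₑ ^ (N + s * p) := by
    refine lintegral_congr_ae ?_
    filter_upwards [ae_restrict_of_ae hfg] with x hx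
    refine lintegral_congr_ae ?_
    filter_upwards [ae_restrict_of_ae hfg] with y hy
    rw [hx, hy]
  rw [e2] at hfin
  rw [e1, e2]
  exact lintegral_fdiff_le_of_measurable hN hp hgm hs0 hs1
    (fun x hx => by rw [hg, indicator_of_notMem hx]) hh hR hfin

end NikolskiiGagliardo

/-! ### Difference quotients and weak directional derivatives -/

section DifferenceQuotients

open Filter Topology

variable {N : ℕ} {q : ℝ≥0∞} {v : RN N → ℝ} {K Γ : ℝ}

/-- The difference quotient `δ_{be} v / b`. -/
noncomputable def diffQuot (b : ℝ) (e : RN N) (v : RN N → ℝ) : RN N → ℝ :=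
  b⁻¹ • fdiff (b • e) v

lemma MeasureTheory.MemLp.diffQuot (hv : MemLp v q volume) (b : ℝ) (e : RN N) :
    MemLp (diffQuot b e v) q volume :=
  (hv.fdiff _).const_smul _

lemma diffQuot_sub_half {b : ℝ} (hb : b ≠ 0) (e : RN N) (v : RN N → ℝ) :
    diffQuot b e v - diffQuot (b / 2) e v = b⁻¹ • fdiff2 ((b / 2) • e) v := by
  have h := fdiff_eq_half_double ((b / 2) • e) v
  rw [smul_smul, mul_div_cancel₀ _ (two_ne_zero)] at h
  unfold diffQuot
  rw [h]
  ext x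
  simp only [Pi.sub_apply, Pi.smul_apply, smul_eq_mul]
  field_simp
  ring

lemma eLpNorm_diffQuot_sub_half_le {b : ℝ} (hb : 0 < b) {e : RN N} (he : ‖e‖ = 1) (hK : 0 ≤ K)
    (hΓ : 1 ≤ Γ)
    (h2 : ∀ h, eLpNorm (fdiff2 h v) q volume ≤ ENNReal.ofReal (K * ‖h‖ ^ Γ)) :
    eLpNorm (diffQuot b e v - diffQuot (b / 2) e v) q volume ≤
      ENNReal.ofReal (K / 2 * b ^ (Γ - 1)) := by
  rw [diffQuot_sub_half hb.ne', eLpNorm_const_smul, Real.enorm_eq_ofReal (by positivity)]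
  grw [h2]
  rw [← ENNReal.ofReal_mul (by positivity)]
  refine ENNReal.ofReal_le_ofReal ?_
  rw [norm_smul, he, mul_one, Real.norm_of_nonneg (by positivity), Real.div_rpow hb.le (by norm_num),
    Real.rpow_sub hb, Real.rpow_one]
  have h1 : (2 : ℝ) ≤ 2 ^ Γ := by
    simpa using Real.rpow_le_rpow_of_exponent_le (x := 2) (by norm_num) hΓ
  have h3 : b ^ Γ / 2 ^ Γ ≤ b ^ Γ / 2 := by gcongr
  calc b⁻¹ * (K * (b ^ Γ / 2 ^ Γ)) ≤ b⁻¹ * (K * (b ^ Γ / 2)) := by gcongr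
    _ = _ := by field_simp

/-- Writing `h = m + d` and `b e = m - d` reduces the mixed difference to two second differences
with increments of length at most `b`, each costing `K b^Γ`. -/
lemma eLpNorm_fdiff_diffQuot_le {b : ℝ} (hb : 0 < b) {e h : RN N} (he : ‖e‖ = 1) (hK : 0 ≤ K)
    (hq : 1 ≤ q) (hΓ : 1 ≤ Γ) (hh : ‖h‖ ≤ b) (hv : MemLp v q volume)
    (h2 : ∀ h, eLpNorm (fdiff2 h v) q volume ≤ ENNReal.ofReal (K * ‖h‖ ^ Γ)) :
    eLpNorm (fdiff h (diffQuot b e v)) q volume ≤ ENNReal.ofReal (2 * K * b ^ (Γ - 1)) := by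
  set m := (1 / 2 : ℝ) • (h + b • e) with hm
  set d := (1 / 2 : ℝ) • (h - b • e) with hd
  have hbe : ‖b • e‖ = b := by rw [norm_smul, he, mul_one, Real.norm_of_nonneg hb.le]
  have e1 : m + d = h := by
    rw [hm, hd, ← smul_add, add_add_sub_cancel, ← two_smul ℝ h, smul_smul]; norm_num
  have e2 : m - d = b • e := by
    rw [hm, hd, ← smul_sub, add_sub_sub_cancel, ← two_smul ℝ (b • e), smul_smul]; norm_num
  have hmb : ‖m‖ ≤ b := by
    have := norm_add_le h (b • e)
    rw [hm, norm_smul]; norm_num; linarith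
  have hdb : ‖d‖ ≤ b := by
    have := norm_sub_le h (b • e)
    rw [hd, norm_smul]; norm_num; linarith
  have e3 : fdiff h (diffQuot b e v) = b⁻¹ • (fdiff2 m v - fun x => fdiff2 d v (x + b • e)) := by
    have := fdiff_fdiff_eq m d v
    rw [e1, e2] at this
    rw [← this]
    ext x
    simp only [diffQuot, fdiff, Pi.smul_apply, smul_eq_mul]; ring
  have hb' : ∀ k : RN N, ‖k‖ ≤ b → eLpNorm (fdiff2 k v) q volume ≤ ENNReal.ofReal (K * b ^ Γ) := by
    intro k hk
    refine (h2 k).trans (ENNReal.ofReal_le_ofReal ?_)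
    gcongr
  rw [e3, eLpNorm_const_smul, Real.enorm_eq_ofReal (by positivity)]
  grw [eLpNorm_sub_le (hv.fdiff2 m).1 (aestronglyMeasurable_comp_add_right (hv.fdiff2 d).1 _) hq,
    eLpNorm_comp_add_right (hv.fdiff2 d).1, hb' m hmb, hb' d hdb]
  rw [← ENNReal.ofReal_add (by positivity) (by positivity), ← ENNReal.ofReal_mul (by positivity)]
  refine ENNReal.ofReal_le_ofReal (le_of_eq ?_)
  rw [Real.rpow_sub hb, Real.rpow_one]
  field_simp
  ring

/-- If second differences are of order `Γ > 1` in `L^q`, dyadic difference quotients converge. -/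
lemma exists_diffQuot_limit (hq : 1 ≤ q) (hv : MemLp v q volume) (hK : 0 ≤ K) (hΓ : 1 < Γ)
    (hΓ2 : Γ ≤ 2) (h2 : ∀ h, eLpNorm (fdiff2 h v) q volume ≤ ENNReal.ofReal (K * ‖h‖ ^ Γ))
    {e : RN N} (he : ‖e‖ = 1) {a : ℝ} (ha : 0 < a) :
    ∃ g : RN N → ℝ, MemLp g q volume ∧ ∀ j : ℕ, eLpNorm (g - diffQuot (a / 2 ^ j) e v) q volume ≤
      ENNReal.ofReal (K / (Γ - 1) * (a / 2 ^ j) ^ (Γ - 1)) := by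
  have : Fact (1 ≤ q) := ⟨hq⟩
  have hm : ∀ j : ℕ, MemLp (diffQuot (a / 2 ^ j) e v) q volume := fun j => hv.diffQuot _ _
  set f : ℕ → Lp ℝ q (volume : Measure (RN N)) := fun j => (hm j).toLp with hf
  set r : ℝ := 2 ^ (-(Γ - 1)) with hr
  have hr1 : r < 1 := Real.rpow_lt_one_of_one_lt_of_neg (by norm_num) (by linarith)
  have hr0 : 0 < r := by positivity
  have hrj : ∀ j : ℕ, (a / 2 ^ j) ^ (Γ - 1) = a ^ (Γ - 1) * r ^ j := by
    intro j
    rw [Real.div_rpow ha.le (by positivity), hr, ← Real.rpow_natCast, ← Real.rpow_natCast,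
      ← Real.rpow_mul (by norm_num), ← Real.rpow_mul (by norm_num), div_eq_mul_inv,
      ← Real.rpow_neg (by norm_num)]
    ring_nf
  set C := K / 2 * a ^ (Γ - 1) with hC
  have hu : ∀ n, dist (f n) (f (n + 1)) ≤ C * r ^ n := by
    intro n
    have h1 := eLpNorm_diffQuot_sub_half_le (q := q) (b := a / 2 ^ n) (by positivity) he hK hΓ.le h2
    rw [div_div, ← pow_succ, ← Lp.edist_toLp_toLp _ _ (hm n) (hm (n + 1)), edist_dist, hrj] at h1
    rw [hC, mul_assoc]
    exact (ENNReal.ofReal_le_ofReal_iff (by positivity)).1 h1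
  obtain ⟨G, hG⟩ := cauchySeq_tendsto_of_complete (cauchySeq_of_le_geometric r C hr1 hu)
  refine ⟨G, Lp.memLp G, fun j => ?_⟩
  have h1 := dist_le_of_le_geometric_of_tendsto r C hr1 hu hG j
  have h3 : eLpNorm (⇑G - diffQuot (a / 2 ^ j) e v) q volume = ENNReal.ofReal (dist (f j) G) := by
    rw [dist_comm, ← edist_dist, Lp.edist_def]
    exact eLpNorm_congr_ae (Filter.EventuallyEq.rfl.sub (hm j).coeFn_toLp.symm)
  rw [h3, hrj]
  refine ENNReal.ofReal_le_ofReal (h1.trans ?_)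
  -- The geometric tail has denominator `1 - r ≥ (Γ - 1) / 2`. This is where `Γ ≤ 2` enters.
  have h4 := half_mul_le_one_sub_two_rpow_neg (x := Γ - 1) (by linarith) (by linarith)
  have hΓ' : 0 < (Γ - 1) / 2 := by linarith
  calc C * r ^ j / (1 - r) ≤ C * r ^ j / ((Γ - 1) / 2) := by gcongr
    _ = _ := by rw [hC]; field_simp

/-- Discrete integration by parts, from translation invariance of the integral. -/
lemma integral_diffQuot_mul (hv : Integrable v) {φ : RN N → ℝ} (hφ : Continuous φ)
    (hc : HasCompactSupport φ) (b : ℝ) (e : RN N) :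
    ∫ x, diffQuot b e v x * φ x = ∫ x, b⁻¹ • (φ (x + b • (-e)) - φ x) * v x := by
  obtain ⟨C, hC⟩ := hφ.bounded_above_of_compact_support hc
  have hb : ∀ w : RN N, Integrable (fun x => φ (x + w) * v x) := fun w =>
    hv.bdd_mul (c := C) (by fun_prop) (Filter.Eventually.of_forall fun x => hC _)
  have hs : ∫ x, φ x * v (x + b • e) = ∫ x, φ (x + b • (-e)) * v x := by
    rw [← integral_add_right_eq_self _ (b • (-e))]; simp
  have hb0 : Integrable (fun x => φ x * v x) := by simpa using hb 0
  have hb1 : Integrable (fun x => φ x * v (x + b • e)) := by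
    have := (hb (b • (-e))).comp_add_right (b • e)
    simpa using this
  calc ∫ x, diffQuot b e v x * φ x = ∫ x, b⁻¹ * (φ x * v (x + b • e) - φ x * v x) := by
        refine integral_congr_ae (Filter.Eventually.of_forall fun x => ?_)
        simp only [diffQuot, fdiff, Pi.smul_apply, smul_eq_mul]; ring
    _ = ∫ x, b⁻¹ * (φ (x + b • (-e)) * v x - φ x * v x) := by
        rw [integral_const_mul, integral_const_mul, integral_sub hb1 hb0, integral_sub (hb _) hb0, hs]
    _ = _ := by
        refine integral_congr_ae (Filter.Eventually.of_forall fun x => ?_)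
        simp only [smul_eq_mul]; ring

/-- Hölder with conjugate exponent `(1 - q⁻¹)⁻¹`, a form that includes both endpoints. -/
lemma integrable_mul_of_hasCompactSupport (hq : 1 ≤ q) {w φ : RN N → ℝ} (hw : MemLp w q volume)
    (hφ : Continuous φ) (hc : HasCompactSupport φ) : Integrable (fun x => w x * φ x) := by
  have : ENNReal.HolderTriple (1 - q⁻¹)⁻¹ q 1 := ⟨by
    rw [inv_inv, inv_one, tsub_add_cancel_of_le (ENNReal.inv_le_one.2 hq)]⟩
  have hφq : MemLp φ (1 - q⁻¹)⁻¹ volume := hφ.memLp_of_hasCompactSupport hc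
  have : MemLp (φ • w) 1 volume := hw.smul hφq
  refine (memLp_one_iff_integrable.1 this).congr (Filter.Eventually.of_forall fun x => ?_)
  simp [mul_comm]

/-- An `L^q` limit of difference quotients is a weak directional derivative. -/
lemma integral_mul_fderiv_of_diffQuot_limit (hq : 1 ≤ q) (hv : Integrable v) (hvq : MemLp v q volume)
    {g : RN N → ℝ} (hg : MemLp g q volume) {b : ℕ → ℝ} (hb : Tendsto b atTop (𝓝[>] 0)) {e : RN N}
    (hlim : Tendsto (fun j => eLpNorm (g - diffQuot (b j) e v) q volume) atTop (𝓝 0))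
    {φ : RN N → ℝ} (hφ : ContDiff ℝ ∞ φ) (hc : HasCompactSupport φ) :
    ∫ x, v x * fderiv ℝ φ x e = -∫ x, g x * φ x := by
  set q' : ℝ≥0∞ := (1 - q⁻¹)⁻¹ with hq'
  have : ENNReal.HolderTriple q' q 1 := ⟨by
    rw [hq', inv_inv, inv_one, tsub_add_cancel_of_le (ENNReal.inv_le_one.2 hq)]⟩
  have hφq : MemLp φ q' volume := hφ.continuous.memLp_of_hasCompactSupport hc
  have hint : ∀ w : RN N → ℝ, MemLp w q volume → Integrable (fun x => w x * φ x) :=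
    fun w hw => integrable_mul_of_hasCompactSupport hq hw hφ.continuous hc
  have hA : Tendsto (fun j => ∫ x, diffQuot (b j) e v x * φ x) atTop (𝓝 (∫ x, g x * φ x)) := by
    refine tendsto_integral_of_L1' _ (hint g hg).1
      (Filter.Eventually.of_forall fun j => hint _ (hvq.diffQuot _ _)) ?_
    have hb : ∀ j, eLpNorm ((fun x => diffQuot (b j) e v x * φ x) - fun x => g x * φ x) 1 volume ≤
        eLpNorm φ q' volume * eLpNorm (g - diffQuot (b j) e v) q volume := by
      intro j
      have e1 : ((fun x => diffQuot (b j) e v x * φ x) - fun x => g x * φ x) =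
          -(φ • (g - diffQuot (b j) e v)) := by
        ext x; simp; ring
      rw [e1, eLpNorm_neg]
      exact eLpNorm_smul_le_mul_eLpNorm (hg.sub (hvq.diffQuot _ _)).1 hφq.1
    refine tendsto_of_tendsto_of_tendsto_of_le_of_le tendsto_const_nhds ?_ (fun _ => zero_le) hb
    simpa using ENNReal.Tendsto.const_mul hlim (Or.inr hφq.2.ne)
  obtain ⟨D, hD⟩ := ContDiff.lipschitzWith_of_hasCompactSupport hc hφ (by simp)
  -- After the quotient is moved onto the Lipschitz test function, it converges to the derivative
  -- along `-e`. Comparing with the Hölder limit `hA` identifies `g`.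
  have hB := (hD.integral_inv_smul_sub_mul_tendsto_integral_lineDeriv_mul hv (-e)).comp hb
  have hB' : Tendsto (fun j => ∫ x, diffQuot (b j) e v x * φ x) atTop
      (𝓝 (∫ x, lineDeriv ℝ φ x (-e) * v x)) := by
    refine hB.congr fun j => ?_
    rw [integral_diffQuot_mul hv hφ.continuous hc]
    rfl
  rw [tendsto_nhds_unique hA hB', ← integral_neg]
  refine integral_congr_ae (Filter.Eventually.of_forall fun x => ?_)
  simp only [((hφ.differentiable (by simp)) x).lineDeriv_eq_fderiv, map_neg]
  ring

/-- If second differences of `v` are of order `Γ ∈ (1, 2]` in `L^q`, then `v` has a weak directional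
derivative in `L^q` which has first differences of order `Γ - 1`. -/
lemma exists_weak_directional_derivative (hq : 1 ≤ q) (hv : Integrable v) (hvq : MemLp v q volume)
    (hK : 0 ≤ K) (hΓ : 1 < Γ)
    (hΓ2 : Γ ≤ 2) (h2 : ∀ h, eLpNorm (fdiff2 h v) q volume ≤ ENNReal.ofReal (K * ‖h‖ ^ Γ))
    {e : RN N} (he : ‖e‖ = 1) {a : ℝ} (ha : 0 < a) :
    ∃ g : RN N → ℝ, MemLp g q volume ∧
      eLpNorm g q volume ≤ ENNReal.ofReal (K / (Γ - 1) * a ^ (Γ - 1)) +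
        ENNReal.ofReal (2 / a) * eLpNorm v q volume ∧
      (∀ h, h ≠ 0 → ‖h‖ ≤ a → eLpNorm (fun x => g (x + h) - g x) q volume ≤
        ENNReal.ofReal (8 * K / (Γ - 1) * ‖h‖ ^ (Γ - 1))) ∧
      ∀ φ : RN N → ℝ, ContDiff ℝ ∞ φ → HasCompactSupport φ →
        ∫ x, v x * fderiv ℝ φ x e = -∫ x, g x * φ x := by
  obtain ⟨g, hg, hlim⟩ := exists_diffQuot_limit hq hvq hK hΓ hΓ2 h2 he ha
  have hΓ1 : 0 < Γ - 1 := by linarith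
  refine ⟨g, hg, ?_, fun h hh hha => ?_, fun φ hφ hc => ?_⟩
  · have h0 := hlim 0
    simp only [pow_zero, div_one] at h0
    have e1 : g = (g - diffQuot a e v) + diffQuot a e v := by simp
    rw [e1]
    refine (eLpNorm_add_le (hg.sub (hvq.diffQuot _ _)).1 (hvq.diffQuot _ _).1 hq).trans ?_
    gcongr
    unfold diffQuot
    rw [eLpNorm_const_smul, Real.enorm_eq_ofReal (by positivity)]
    grw [eLpNorm_fdiff_le hvq.1 hq]
    rw [← mul_assoc, div_eq_mul_inv, mul_comm 2, ENNReal.ofReal_mul (by positivity)]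
    simp
  · have hn : 0 < ‖h‖ := norm_pos_iff.2 hh
    -- Select the dyadic scale `b = a / 2^j` with `b / 2 < |h| ≤ b`.
    obtain ⟨j, hj1, hj2⟩ := exists_nat_pow_near_of_lt_one (x := ‖h‖ / a) (y := 1 / 2) (by positivity)
      ((div_le_one ha).2 hha) (by norm_num) (by norm_num)
    set b := a / 2 ^ j with hb
    have hb0 : 0 < b := by positivity
    have hhb : ‖h‖ ≤ b := by
      rw [div_le_iff₀ ha] at hj2
      rw [hb]
      calc _ ≤ _ := hj2
        _ = _ := by rw [one_div, inv_pow]; field_simp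
    have hbh : b ≤ 2 * ‖h‖ := by
      rw [lt_div_iff₀ ha] at hj1
      have : (1 / 2 : ℝ) ^ (j + 1) * a = b / 2 := by rw [hb, one_div, inv_pow, pow_succ]; field_simp
      linarith
    have hbp : b ^ (Γ - 1) ≤ 2 * ‖h‖ ^ (Γ - 1) := by
      calc b ^ (Γ - 1) ≤ (2 * ‖h‖) ^ (Γ - 1) := by gcongr
        _ = 2 ^ (Γ - 1) * ‖h‖ ^ (Γ - 1) := Real.mul_rpow (by norm_num) hn.le
        _ ≤ 2 ^ (1 : ℝ) * ‖h‖ ^ (Γ - 1) := by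
          gcongr
          · norm_num
          · linarith
        _ = _ := by simp
    -- At this scale the error `g - diffQuot b e v` is already of size `b^{Γ-1}`, and so is `δ_h` of
    -- the quotient itself.
    have e1 : (fun x => g (x + h) - g x) = (fun x => (g - diffQuot b e v) (x + h) -
        (g - diffQuot b e v) x) + fdiff h (diffQuot b e v) := by
      ext x; simp [fdiff]; ring
    have hgd := hg.sub (hvq.diffQuot b e)
    rw [e1]
    refine (eLpNorm_add_le (f := fun x => (g - diffQuot b e v) (x + h) - (g - diffQuot b e v) x)
      ((aestronglyMeasurable_comp_add_right hgd.1 h).sub hgd.1)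
      ((hvq.diffQuot b e).fdiff h).1 hq).trans ?_
    grw [eLpNorm_sub_shift_le hgd.1 hq, hlim j,
      eLpNorm_fdiff_diffQuot_le hb0 he hK hq hΓ.le hhb hvq h2]
    rw [two_mul, ← ENNReal.ofReal_add (by positivity) (by positivity), ← two_mul,
      ← ENNReal.ofReal_add (by positivity) (by positivity)]
    refine ENNReal.ofReal_le_ofReal ?_
    have hKΓ : K ≤ K / (Γ - 1) := le_div_self hK hΓ1 (by linarith)
    calc 2 * (K / (Γ - 1) * b ^ (Γ - 1)) + 2 * K * b ^ (Γ - 1) ≤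
        2 * (K / (Γ - 1) * b ^ (Γ - 1)) + 2 * (K / (Γ - 1)) * b ^ (Γ - 1) := by gcongr
      _ = 4 * (K / (Γ - 1)) * b ^ (Γ - 1) := by ring
      _ ≤ 4 * (K / (Γ - 1)) * (2 * ‖h‖ ^ (Γ - 1)) := by gcongr
      _ = _ := by ring
  · have hbt : Tendsto (fun j : ℕ => a / 2 ^ j) atTop (𝓝 0) := by
      have := (tendsto_pow_atTop_nhds_zero_of_lt_one (r := (1 / 2 : ℝ)) (by norm_num)
        (by norm_num)).const_mul a
      rw [mul_zero] at this
      refine this.congr fun j => ?_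
      rw [one_div, inv_pow, div_eq_mul_inv]
    refine integral_mul_fderiv_of_diffQuot_limit hq hv hvq hg (b := fun j => a / 2 ^ j) ?_ ?_ hφ hc
    · exact tendsto_nhdsWithin_iff.2 ⟨hbt, Filter.Eventually.of_forall fun j => by
        simp only [mem_Ioi]; positivity⟩
    · refine tendsto_of_tendsto_of_tendsto_of_le_of_le tendsto_const_nhds ?_ (fun _ => zero_le) hlim
      have h1 : Tendsto (fun j : ℕ => K / (Γ - 1) * (a / 2 ^ j) ^ (Γ - 1)) atTop (𝓝 0) := by
        have := (hbt.rpow_const (p := Γ - 1) (Or.inr hΓ1.le)).const_mul (K / (Γ - 1))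
        rwa [Real.zero_rpow hΓ1.ne', mul_zero] at this
      simpa using ENNReal.tendsto_ofReal h1

end DifferenceQuotients

/-! ### Assembling the weak gradient from coordinate directions -/

section Gradient

variable {N : ℕ} {q : ℝ≥0∞} {v : RN N → ℝ} {K Γ : ℝ}

lemma eLpNorm_sum_smul_single_le (hq : 1 ≤ q) {g : Fin N → RN N → ℝ}
    (hg : ∀ i, AEStronglyMeasurable (g i) volume) {A : ℝ≥0∞} (hA : ∀ i, eLpNorm (g i) q volume ≤ A) :
    eLpNorm (fun x => ∑ i, g i x • EuclideanSpace.single i (1 : ℝ)) q volume ≤ N * A := by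
  have e : (fun x => ∑ i, g i x • EuclideanSpace.single i (1 : ℝ)) =
      ∑ i, fun x => g i x • EuclideanSpace.single i (1 : ℝ) := by
    ext1 x; simp
  rw [e]
  refine (eLpNorm_sum_le (fun i _ => (hg i).smul_const _) hq).trans ?_
  calc _ ≤ ∑ _i : Fin N, A := by
        refine Finset.sum_le_sum fun i _ => le_trans (le_of_eq ?_) (hA i)
        refine eLpNorm_congr_norm_ae (Filter.Eventually.of_forall fun x => ?_)
        simp [norm_smul]
    _ = _ := by simp

/-- If second differences of `v` are of order `Γ ∈ (1, 2]` in `L^q`, then `v` has a weak gradient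
in `L^q` which has first differences of order `Γ - 1`. -/
lemma exists_weak_gradient (hq : 1 ≤ q) (hv : Integrable v) (hvq : MemLp v q volume)
    (hK : 0 ≤ K) (hΓ : 1 < Γ)
    (hΓ2 : Γ ≤ 2) (h2 : ∀ h, eLpNorm (fdiff2 h v) q volume ≤ ENNReal.ofReal (K * ‖h‖ ^ Γ))
    {a : ℝ} (ha : 0 < a) :
    ∃ G : RN N → RN N, MemLp G q volume ∧
      eLpNorm G q volume ≤ N * (ENNReal.ofReal (K / (Γ - 1) * a ^ (Γ - 1)) +
        ENNReal.ofReal (2 / a) * eLpNorm v q volume) ∧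
      (∀ h, h ≠ 0 → ‖h‖ ≤ a → eLpNorm (fun x => G (x + h) - G x) q volume ≤
        N * ENNReal.ofReal (8 * K / (Γ - 1) * ‖h‖ ^ (Γ - 1))) ∧
      ∀ φ : RN N → ℝ, ContDiff ℝ ∞ φ → HasCompactSupport φ → ∀ w : RN N,
        ∫ x, v x * fderiv ℝ φ x w = -∫ x, inner ℝ (G x) w * φ x := by
  have hex := fun i : Fin N => exists_weak_directional_derivative hq hv hvq hK hΓ hΓ2 h2
    (e := EuclideanSpace.single i (1 : ℝ)) (by simp) ha
  choose g hg hgn hgd hgw using hex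
  refine ⟨fun x => ∑ i, g i x • EuclideanSpace.single i (1 : ℝ), ?_,
    eLpNorm_sum_smul_single_le hq (fun i => (hg i).1) hgn, fun h hh hha => ?_, fun φ hφ hc w => ?_⟩
  · refine memLp_finsetSum _ fun i _ => ?_
    refine MemLp.of_le (hg i) ((hg i).1.smul_const _) (Filter.Eventually.of_forall fun x => ?_)
    simp [norm_smul]
  · have e : (fun x => ∑ i, g i (x + h) • EuclideanSpace.single i (1 : ℝ) -
        ∑ i, g i x • EuclideanSpace.single i (1 : ℝ)) =
        fun x => ∑ i, (g i (x + h) - g i x) • EuclideanSpace.single i (1 : ℝ) := by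
      ext1 x; simp only [sub_smul, Finset.sum_sub_distrib]
    simp only [e]
    exact eLpNorm_sum_smul_single_le hq (g := fun i x => g i (x + h) - g i x)
      (fun i => (aestronglyMeasurable_comp_add_right (hg i).1 h).sub (hg i).1)
      (fun i => hgd i h hh hha)
  · have hw : w = ∑ i, w i • EuclideanSpace.single i (1 : ℝ) := by
      ext j; simp [Finset.sum_apply, Pi.single_apply]
    have hfd : ∀ x, v x * fderiv ℝ φ x w =
        ∑ i, w i * (v x * fderiv ℝ φ x (EuclideanSpace.single i (1 : ℝ))) := by
      intro x
      conv_lhs => rw [hw]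
      simp only [map_sum, map_smul, smul_eq_mul, Finset.mul_sum]
      exact Finset.sum_congr rfl fun i _ => by ring
    have hin : ∀ x, inner ℝ (∑ i, g i x • EuclideanSpace.single i (1 : ℝ)) w * φ x =
        ∑ i, w i * (g i x * φ x) := by
      intro x
      simp only [sum_inner, inner_smul_left, Finset.sum_mul]
      refine Finset.sum_congr rfl fun i _ => ?_
      simp [EuclideanSpace.inner_single_left]
      ring
    simp only [hfd, hin]
    rw [integral_finsetSum, integral_finsetSum, ← Finset.sum_neg_distrib]
    · refine Finset.sum_congr rfl fun i _ => ?_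
      rw [integral_const_mul, integral_const_mul, hgw i φ hφ hc, mul_neg]
    · intro i _
      exact (integrable_mul_of_hasCompactSupport hq (hg i) hφ.continuous hc).const_mul _
    · intro i _
      have hcf : HasCompactSupport fun x => fderiv ℝ φ x (EuclideanSpace.single i (1 : ℝ)) :=
        hc.fderiv_apply ℝ _
      have hcc : Continuous fun x => fderiv ℝ φ x (EuclideanSpace.single i (1 : ℝ)) :=
        (hφ.continuous_fderiv (by simp)).clm_apply continuous_const
      exact (integrable_mul_of_hasCompactSupport hq hvq hcc hcf).const_mul _

end Gradient

/-! ### From first differences to the Gagliardo seminorm -/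

section Gagliardo

variable {N : ℕ} {F : Type*} [NormedAddCommGroup F]

lemma integral_Ioi_piecewise_rpow {a α τ A B : ℝ} (ha : 0 < a) (hα : 0 < α) (hτ : 0 < τ) :
    IntegrableOn (fun y => if y ≤ a then A * y ^ (α - 1) else B * y ^ (-τ - 1)) (Ioi (0 : ℝ)) ∧
    ∫ y in Ioi (0 : ℝ), (if y ≤ a then A * y ^ (α - 1) else B * y ^ (-τ - 1)) =
      A * a ^ α / α + B * a ^ (-τ) / τ := by
  have i1 : IntegrableOn (fun y : ℝ => A * y ^ (α - 1)) (Ioc 0 a) :=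
    ((intervalIntegral.intervalIntegrable_rpow' (by linarith)).1).const_mul A
  have i2 : IntegrableOn (fun y : ℝ => B * y ^ (-τ - 1)) (Ioi a) :=
    (integrableOn_Ioi_rpow_of_lt (by linarith) ha).const_mul B
  have e1 : EqOn (fun y => if y ≤ a then A * y ^ (α - 1) else B * y ^ (-τ - 1))
      (fun y : ℝ => A * y ^ (α - 1)) (Ioc 0 a) := fun y hy => if_pos hy.2
  have e2 : EqOn (fun y => if y ≤ a then A * y ^ (α - 1) else B * y ^ (-τ - 1))
      (fun y : ℝ => B * y ^ (-τ - 1)) (Ioi a) := fun y hy => if_neg (not_le.2 hy)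
  have j1 := i1.congr_fun e1.symm measurableSet_Ioc
  have j2 := i2.congr_fun e2.symm measurableSet_Ioi
  rw [← Ioc_union_Ioi_eq_Ioi ha.le]
  refine ⟨j1.union j2, ?_⟩
  rw [setIntegral_union Ioc_disjoint_Ioi_same measurableSet_Ioi j1 j2,
    setIntegral_congr_fun measurableSet_Ioc e1, setIntegral_congr_fun measurableSet_Ioi e2,
    integral_const_mul, integral_const_mul, ← intervalIntegral.integral_of_le ha.le,
    integral_rpow (Or.inl (by linarith)), integral_Ioi_rpow_of_lt (by linarith) ha, sub_add_cancel,
    sub_add_cancel, Real.zero_rpow hα.ne']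
  field_simp
  ring

/-- Polar coordinates: `N` times the volume of the unit ball is the area of the sphere, and the
radial density `y^{N-1}` turns the exponents into `α - 1` and `-τ - 1`. -/
lemma lintegral_piecewise_norm_rpow (hN : 1 ≤ N) {a α τ A B : ℝ} (ha : 0 < a) (hα : 0 < α)
    (hτ : 0 < τ) (hA : 0 ≤ A) (hB : 0 ≤ B) :
    ∫⁻ k : RN N, ENNReal.ofReal (if ‖k‖ ≤ a then A * ‖k‖ ^ (α - N) else B * ‖k‖ ^ (-τ - N)) =
      ENNReal.ofReal (N * (volume (ball (0 : RN N) 1)).toReal *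
        (A * a ^ α / α + B * a ^ (-τ) / τ)) := by
  have : Nontrivial (RN N) := by
    have : Nonempty (Fin N) := ⟨⟨0, hN⟩⟩
    infer_instance
  set ψ : ℝ → ℝ := fun y => if y ≤ a then A * y ^ (α - N) else B * y ^ (-τ - N) with hψ
  have he : ∀ y ∈ Ioi (0 : ℝ), y ^ (Module.finrank ℝ (RN N) - 1) • ψ y =
      if y ≤ a then A * y ^ (α - 1) else B * y ^ (-τ - 1) := by
    intro y hy
    have hy0 : (0 : ℝ) < y := hy
    have hpow : ∀ x : ℝ, y ^ (N - 1) * y ^ (x - N) = y ^ (x - 1) := by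
      intro x
      rw [← Real.rpow_natCast, ← Real.rpow_add hy0, Nat.cast_sub hN]
      congr 1; push_cast; ring
    rw [finrank_euclideanSpace_fin, smul_eq_mul, hψ]
    dsimp only
    split_ifs
    · rw [mul_left_comm, hpow]
    · rw [mul_left_comm, hpow]
  obtain ⟨hi, hv⟩ := integral_Ioi_piecewise_rpow (A := A) (B := B) ha hα hτ
  have hint : Integrable (fun k : RN N => ψ ‖k‖) :=
    (integrable_fun_norm_addHaar volume).2 ((integrableOn_congr_fun he measurableSet_Ioi).2 hi)
  rw [← ofReal_integral_eq_lintegral_ofReal (f := fun k : RN N => ψ ‖k‖) hint]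
  · rw [integral_fun_norm_addHaar, setIntegral_congr_fun measurableSet_Ioi he, hv,
      finrank_euclideanSpace_fin]
    simp [Measure.real, mul_assoc]
  · refine Filter.Eventually.of_forall fun k => ?_
    simp only [hψ, Pi.zero_apply]
    split_ifs <;> positivity

lemma lintegral_gagliardo_eq {p : ℝ} (q : ℝ) {g : RN N → F} (hg : StronglyMeasurable g) :
    ∫⁻ x, ∫⁻ y, ‖g x - g y‖ₑ ^ p / ‖x - y‖ₑ ^ q =
      ∫⁻ k, (∫⁻ x, ‖g (x + k) - g x‖ₑ ^ p) / ‖k‖ₑ ^ q := by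
  have hm : Measurable fun z : RN N × RN N => ‖g (z.1 + z.2) - g z.1‖ₑ ^ p := by
    have h1 : StronglyMeasurable fun z : RN N × RN N => g (z.1 + z.2) - g z.1 :=
      (hg.comp_measurable (by fun_prop)).sub (hg.comp_measurable (by fun_prop))
    exact h1.enorm.pow_const p
  calc _ = ∫⁻ x, ∫⁻ k, ‖g (x + k) - g x‖ₑ ^ p / ‖k‖ₑ ^ q := by
        refine lintegral_congr fun x => ?_
        rw [← lintegral_add_left_eq_self _ x]
        refine lintegral_congr fun k => ?_
        rw [sub_add_cancel_left, enorm_neg, enorm_sub_rev]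
    _ = ∫⁻ k, ∫⁻ x, ‖g (x + k) - g x‖ₑ ^ p / ‖k‖ₑ ^ q := by
        refine lintegral_lintegral_swap ?_
        exact (hm.div (by fun_prop)).aemeasurable
    _ = _ := by
        refine lintegral_congr fun k => ?_
        simp only [div_eq_mul_inv]
        rw [lintegral_mul_const]
        exact hm.comp (by fun_prop : Measurable fun x : RN N => (x, k))

/-- First differences of order `β > τ` in `L^p` bound the Gagliardo seminorm of order `τ`. -/
lemma gagliardo_rpow_le (hN : 1 ≤ N) {p τ β a K L : ℝ} (hp : 1 ≤ p) (hτ : 0 < τ) (hβ : τ < β)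
    (ha : 0 < a) (hK : 0 ≤ K) (hL : 0 ≤ L) {g : RN N → F} (hg : AEStronglyMeasurable g volume)
    (hgL : eLpNorm g (ENNReal.ofReal p) volume ≤ ENNReal.ofReal L)
    (hgK : ∀ h, h ≠ 0 → ‖h‖ ≤ a → eLpNorm (fun x => g (x + h) - g x) (ENNReal.ofReal p) volume ≤
      ENNReal.ofReal (K * ‖h‖ ^ β)) (S : Set (RN N)) :
    gagliardo τ p g S ^ p ≤ ENNReal.ofReal (N * (volume (ball (0 : RN N) 1)).toReal *
      (K ^ p * a ^ ((β - τ) * p) / ((β - τ) * p) + (2 * L) ^ p * a ^ (-(τ * p)) / (τ * p))) := by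
  have hp0 : 0 < p := by linarith
  have hq0 : 0 < (N : ℝ) + τ * p := by positivity
  rw [gagliardo, ← ENNReal.rpow_mul, one_div, inv_mul_cancel₀ hp0.ne', ENNReal.rpow_one,
    ← lintegral_piecewise_norm_rpow hN ha (mul_pos (by linarith) hp0) (by positivity)
      (by positivity) (by positivity)]
  set g' := hg.mk g with hg'
  have hgg : g =ᵐ[volume] g' := hg.ae_eq_mk
  have hshift : ∀ h, ∫⁻ x, ‖g' (x + h) - g' x‖ₑ ^ p =
      eLpNorm (fun x => g (x + h) - g x) (ENNReal.ofReal p) volume ^ p := by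
    intro h
    rw [eLpNorm_ofReal_rpow hp0]
    refine lintegral_congr_ae ?_
    filter_upwards [hgg, (measurePreserving_add_right volume h).quasiMeasurePreserving.ae_eq_comp hgg]
      with x hx hx'
    simp only [Function.comp_apply] at hx'
    rw [hx, hx']
  calc _ ≤ ∫⁻ x, ∫⁻ y, ‖g x - g y‖ₑ ^ p / ‖x - y‖ₑ ^ (N + τ * p) :=
        (setLIntegral_le_lintegral _ _).trans
          (lintegral_mono fun x => setLIntegral_le_lintegral _ _)
    _ = ∫⁻ x, ∫⁻ y, ‖g' x - g' y‖ₑ ^ p / ‖x - y‖ₑ ^ (N + τ * p) := by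
        refine lintegral_congr_ae ?_
        filter_upwards [hgg] with x hx
        refine lintegral_congr_ae ?_
        filter_upwards [hgg] with y hy
        rw [hx, hy]
    _ = ∫⁻ k, (∫⁻ x, ‖g' (x + k) - g' x‖ₑ ^ p) / ‖k‖ₑ ^ (N + τ * p) :=
        lintegral_gagliardo_eq _ hg.stronglyMeasurable_mk
    _ ≤ _ := by
        refine lintegral_mono fun k => ?_
        dsimp only
        rw [hshift]
        -- At `k = 0` the quotient is `0 / 0 = 0`. Elsewhere `|k| ≤ a` uses the difference bound and
        -- `|k| > a` the bound by twice the norm of `g`.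
        rcases eq_or_ne k 0 with rfl | hk
        · simp [hp0, hq0]
        have hn : 0 < ‖k‖ := norm_pos_iff.2 hk
        rw [← ofReal_norm, ENNReal.ofReal_rpow_of_pos hn]
        refine ENNReal.div_le_of_le_mul ?_
        split_ifs with hka
        · grw [hgK k hk hka]
          rw [← ENNReal.ofReal_mul (by positivity),
            ENNReal.ofReal_rpow_of_nonneg (by positivity) hp0.le]
          refine ENNReal.ofReal_le_ofReal (le_of_eq ?_)
          rw [Real.mul_rpow hK (by positivity), ← Real.rpow_mul hn.le, mul_assoc,
            ← Real.rpow_add hn]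
          congr 2; ring
        · grw [eLpNorm_sub_shift_le hg (by simpa using hp), hgL]
          rw [← ENNReal.ofReal_mul (by positivity), two_mul, ← ENNReal.ofReal_add hL hL, ← two_mul,
            ENNReal.ofReal_rpow_of_nonneg (by positivity) hp0.le]
          refine ENNReal.ofReal_le_ofReal (le_of_eq ?_)
          rw [mul_assoc, ← Real.rpow_add hn]
          have : -(τ * p) - N + (N + τ * p) = 0 := by ring
          rw [this, Real.rpow_zero, mul_one]

end Gagliardo

/-! ### Second differences of order `θ + s` -/

section SecondDifferences

variable {N : ℕ}

lemma gagliardo_rpow {F : Type*} [NormedAddCommGroup F] {α p : ℝ} (hp : 0 < p) (ψ : RN N → F)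
    (A : Set (RN N)) : gagliardo α p ψ A ^ p =
      ∫⁻ x in A, ∫⁻ y in A, ‖ψ x - ψ y‖ₑ ^ p / ‖x - y‖ₑ ^ ((N : ℝ) + α * p) := by
  rw [gagliardo, ← ENNReal.rpow_mul, one_div, inv_mul_cancel₀ hp.ne', ENNReal.rpow_one]

lemma fdiff2_zero (v : RN N → ℝ) : fdiff2 0 v = 0 := by
  ext x; simp [fdiff2, fdiff]

/-- Apply `lintegral_fdiff_le` to `δ_h v / |h|^θ` with the same `h`. Each of the two differences
enlarges the support by `|h|`, which explains `ρ₀ + 2 h₀ ≤ R`. -/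
lemma eLpNorm_fdiff2_rpow_le_of_lt (hN : 1 ≤ N) {p θ s h₀ ρ₀ R : ℝ} (hp : 1 ≤ p) (hs0 : 0 < s)
    (hs1 : s < 1) {x₀ : RN N} (hR : ρ₀ + 2 * h₀ ≤ R) {v : RN N → ℝ}
    (hv : AEStronglyMeasurable v volume) (h0 : ∀ x, x ∉ ball x₀ ρ₀ → v x = 0)
    (hM : supGagliardo θ s p h₀ v (ball x₀ R) < ⊤) {h : RN N} (hh : h ≠ 0) (hh₀ : ‖h‖ < h₀) :
    eLpNorm (fdiff2 h v) (ENNReal.ofReal p) volume ^ p ≤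
      ENNReal.ofReal (nikolskiiConst N p * ‖h‖ ^ ((θ + s) * p)) *
        (ENNReal.ofReal (1 - s) * supGagliardo θ s p h₀ v (ball x₀ R)) := by
  have hp0 : 0 < p := by linarith
  have hn : 0 < ‖h‖ := norm_pos_iff.2 hh
  set M := supGagliardo θ s p h₀ v (ball x₀ R) with hMd
  set f : RN N → ℝ := fun x => fdiff h v x / ‖h‖ ^ θ with hf
  have hfM : gagliardo s p f (ball x₀ R) ^ p ≤ M :=
    le_iSup₂ (f := fun (h : RN N) (_ : 0 < ‖h‖ ∧ ‖h‖ < h₀) =>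
      gagliardo s p (fun x => fdiff h v x / ‖h‖ ^ θ) (ball x₀ R) ^ p) h ⟨hn, hh₀⟩
  have hfm : AEStronglyMeasurable f volume := by
    simp only [hf, div_eq_mul_inv]
    exact (aestronglyMeasurable_fdiff hv h).mul_const _
  have hf0 : ∀ x, x ∉ ball x₀ (ρ₀ + ‖h‖) → f x = 0 := by
    intro x hx
    have h1 : x ∉ ball x₀ ρ₀ := fun hc => hx (ball_subset_ball (by linarith) hc)
    have h2 : x + h ∉ ball x₀ ρ₀ := by
      intro hc
      apply hx
      have := dist_triangle x (x + h) x₀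
      have d : dist x (x + h) = ‖h‖ := by simp
      rw [mem_ball] at hc ⊢
      linarith
    simp [hf, fdiff, h0 _ h1, h0 _ h2]
  rw [gagliardo_rpow hp0] at hfM
  have key := lintegral_fdiff_le hN hp hfm hs0 hs1 hf0 hh (R := R) (by linarith)
    (ne_top_of_le_ne_top hM.ne hfM)
  grw [hfM] at key
  have e : fdiff2 h v = (‖h‖ ^ θ) • fdiff h f := by
    ext x
    simp only [hf, fdiff2, fdiff, Pi.smul_apply, smul_eq_mul]
    field_simp
  rw [e, eLpNorm_const_smul, ENNReal.mul_rpow_of_nonneg _ _ hp0.le, eLpNorm_ofReal_rpow hp0,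
    Real.enorm_eq_ofReal (by positivity), ENNReal.ofReal_rpow_of_nonneg (by positivity) hp0.le]
  grw [key]
  have hκ := nikolskiiConst_pos (N := N) hp0
  rw [← mul_assoc, ← mul_assoc, ← ENNReal.ofReal_mul (by positivity),
    ← ENNReal.ofReal_mul (by positivity)]
  apply le_of_eq
  congr 2
  rw [add_mul, Real.rpow_add hn, ← Real.rpow_mul hn.le]
  ring

lemma eLpNorm_fdiff2_rpow_le (hN : 1 ≤ N) {p θ s h₀ ρ₀ R : ℝ} (hp : 1 ≤ p) (hs0 : 0 < s)
    (hs1 : s < 1) (hθ : 0 ≤ θ) {x₀ : RN N} (hh₀ : 0 < h₀) (hR : ρ₀ + 2 * h₀ ≤ R) {v : RN N → ℝ}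
    (hv : MemLp v (ENNReal.ofReal p) volume) (h0 : ∀ x, x ∉ ball x₀ ρ₀ → v x = 0)
    (hM : supGagliardo θ s p h₀ v (ball x₀ R) < ⊤) {h : RN N} (hh : h ≠ 0) :
    eLpNorm (fdiff2 h v) (ENNReal.ofReal p) volume ^ p ≤
      ENNReal.ofReal ((nikolskiiConst N p + 4 ^ p) * ‖h‖ ^ ((θ + s) * p)) *
        (ENNReal.ofReal (1 - s) * supGagliardo θ s p h₀ v (ball x₀ R) +
          ENNReal.ofReal (h₀ ^ (-((θ + s) * p))) * eLpNorm v (ENNReal.ofReal p) volume ^ p) := by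
  have hp0 : 0 < p := by linarith
  have hκ := nikolskiiConst_pos (N := N) hp0
  rcases lt_or_ge ‖h‖ h₀ with hlt | hge
  · refine (eLpNorm_fdiff2_rpow_le_of_lt hN hp hs0 hs1 hR hv.1 h0 hM hh hlt).trans ?_
    gcongr
    · linarith [Real.rpow_pos_of_pos (show (0 : ℝ) < 4 by norm_num) p]
    · exact le_self_add
  · grw [eLpNorm_fdiff2_le hv (by simpa using hp) h]
    grw [← le_add_self (a := ENNReal.ofReal (h₀ ^ (-((θ + s) * p))) *
      eLpNorm v (ENNReal.ofReal p) volume ^ p)]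
    rw [ENNReal.mul_rpow_of_nonneg _ _ hp0.le, ← mul_assoc, ← ENNReal.ofReal_mul (by positivity)]
    gcongr
    have e4 : (4 : ℝ≥0∞) ^ p = ENNReal.ofReal (4 ^ p) := by
      rw [← ENNReal.ofReal_rpow_of_pos (by norm_num)]; simp
    rw [e4]
    refine ENNReal.ofReal_le_ofReal ?_
    have h1 : h₀ ^ ((θ + s) * p) ≤ ‖h‖ ^ ((θ + s) * p) := by gcongr
    have h2 : 1 ≤ ‖h‖ ^ ((θ + s) * p) * h₀ ^ (-((θ + s) * p)) := by
      rw [Real.rpow_neg hh₀.le, ← div_eq_mul_inv]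
      exact (one_le_div (by positivity)).2 h1
    have h4 : (0 : ℝ) < 4 ^ p := by positivity
    rw [mul_assoc]
    nlinarith

lemma le_ofReal_mul_of_rpow_le {p A T : ℝ} (hp : 0 < p) (hA : 0 ≤ A) (hT : 0 ≤ T) {X : ℝ≥0∞}
    (h : X ^ p ≤ ENNReal.ofReal A * ENNReal.ofReal (T ^ p)) :
    X ≤ ENNReal.ofReal (A ^ (1 / p) * T) := by
  rw [← ENNReal.rpow_le_rpow_iff hp]
  refine h.trans (le_of_eq ?_)
  rw [ENNReal.ofReal_rpow_of_nonneg (by positivity) hp.le, Real.mul_rpow (by positivity) hT,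
    ← Real.rpow_mul hA, one_div, inv_mul_cancel₀ hp.ne', Real.rpow_one, ENNReal.ofReal_mul hA]

lemma rpow_le_of_le_ofReal_mul {p D T C : ℝ} (hp : 0 < p) (hD : 0 ≤ D) (hT : 0 ≤ T) {X B : ℝ≥0∞}
    (h : X ≤ ENNReal.ofReal (D * T)) (hC : D ^ p ≤ C) (hB : ENNReal.ofReal (T ^ p) ≤ B) :
    X ^ p ≤ ENNReal.ofReal C * B := by
  grw [h, ← hB, ← hC]
  rw [ENNReal.ofReal_rpow_of_nonneg (by positivity) hp.le, Real.mul_rpow hD hT,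
    ENNReal.ofReal_mul (by positivity)]

lemma besovSeminorm_le {Γ p K : ℝ} {v : RN N → ℝ}
    (h2 : ∀ h, eLpNorm (fdiff2 h v) (ENNReal.ofReal p) volume ≤ ENNReal.ofReal (K * ‖h‖ ^ Γ)) :
    besovSeminorm Γ p v ≤ ENNReal.ofReal K := by
  refine iSup₂_le fun h hh => ?_
  have e : (fun x => fdiff2 h v x / ‖h‖ ^ Γ) = (‖h‖ ^ Γ)⁻¹ • fdiff2 h v := by
    ext x; simp [div_eq_inv_mul]
  rw [lpNormOn, Measure.restrict_univ, e, eLpNorm_const_smul, Real.enorm_eq_ofReal (by positivity)]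
  grw [h2]
  rw [← ENNReal.ofReal_mul (by positivity)]
  refine ENNReal.ofReal_le_ofReal (le_of_eq ?_)
  field_simp

end SecondDifferences

/-! ### Multiplication by the cut-off and its removal -/

section Cutoff

variable {N : ℕ} {c r R : ℝ} {x₀ : RN N} {η u : RN N → ℝ}

lemma IsCutoff.const_nonneg (hη : IsCutoff c x₀ r R η) (hrR : r < R) : 0 ≤ c := by
  have h := (norm_nonneg _).trans (hη.norm_fderiv_le 0)
  rwa [le_div_iff₀ (by linarith), zero_mul] at h

lemma IsCutoff.abs_sub_le (hη : IsCutoff c x₀ r R η) (x h : RN N) :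
    |η (x + h) - η x| ≤ c / (R - r) * ‖h‖ := by
  have := Convex.norm_image_sub_le_of_norm_fderiv_le (𝕜 := ℝ) (f := η) (s := univ) (x := x)
    (y := x + h) (fun x _ => (hη.contDiff.differentiable (by simp)) x)
    (fun x _ => hη.norm_fderiv_le x) convex_univ (mem_univ _) (mem_univ _)
  simpa using this

/-- Since `u` is only locally integrable in `Ω`, it is replaced by its truncation, which is globally
in `L^p`. -/
lemma IsCutoff.mul_eq_indicator_mul (hη : IsCutoff c x₀ r R η) (hrR : r < R) (u : RN N → ℝ) :
    (fun x => u x * η x) = fun x => (closedBall x₀ R).indicator u x * η x := by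
  ext x
  by_cases hx : x ∈ closedBall x₀ R
  · rw [indicator_of_mem hx]
  · rw [hη.eq_zero x (fun hc => hx (ball_subset_closedBall (ball_subset_ball (by linarith) hc)))]
    simp

lemma IsCutoff.norm_mul_le (hη : IsCutoff c x₀ r R η) (w : RN N → ℝ) (x : RN N) :
    ‖w x * η x‖ ≤ ‖w x‖ := by
  rw [norm_mul, Real.norm_of_nonneg (hη.nonneg x)]
  exact mul_le_of_le_one_right (norm_nonneg _) (hη.le_one x)

lemma IsCutoff.memLp_mul (hη : IsCutoff c x₀ r R η) {q : ℝ≥0∞} {w : RN N → ℝ}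
    (hw : MemLp w q volume) : MemLp (fun x => w x * η x) q volume :=
  hw.mono (hw.1.mul hη.contDiff.continuous.aestronglyMeasurable)
    (Filter.Eventually.of_forall (hη.norm_mul_le w))

/-- As `η x = 1`, the product rule reads `η(x + h) δ_h u = δ_h (u η) - u δ_h η`. For such small `h`
the gradient bound keeps `η(x + h) ≥ 1/2`, so one may divide by it. -/
lemma IsCutoff.norm_fdiff_le (hη : IsCutoff c x₀ r R η) (hrR : r < R) {x h : RN N}
    (hx : x ∈ ball x₀ r) (hh : 2 * c * ‖h‖ ≤ R - r) :
    ‖fdiff h u x‖ ≤ 2 * ‖fdiff h (fun x => u x * η x) x‖ + 2 * c * ‖h‖ / (R - r) * ‖u x‖ := by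
  have h1 := hη.abs_sub_le x h
  have hRr : 0 < R - r := by linarith
  rw [hη.eq_one x hx] at h1
  have h2 : c / (R - r) * ‖h‖ ≤ 1 / 2 := by
    rw [div_mul_eq_mul_div, div_le_iff₀ hRr]; linarith
  have h3 : 1 / 2 ≤ η (x + h) := by linarith [(abs_le.1 h1).1]
  have e : η (x + h) * fdiff h u x = fdiff h (fun x => u x * η x) x - u x * (η (x + h) - 1) := by
    simp only [fdiff, hη.eq_one x hx]; ring
  have h4 : η (x + h) * |fdiff h u x| ≤
      |fdiff h (fun x => u x * η x) x| + |u x| * (c / (R - r) * ‖h‖) := by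
    rw [← abs_of_nonneg (hη.nonneg (x + h)), ← abs_mul, e]
    refine (abs_sub _ _).trans ?_
    rw [abs_mul]
    gcongr
  have h5 : 1 / 2 * |fdiff h u x| ≤ η (x + h) * |fdiff h u x| := by gcongr
  simp only [Real.norm_eq_abs]
  have h6 : 2 * c * ‖h‖ / (R - r) * |u x| = 2 * (|u x| * (c / (R - r) * ‖h‖)) := by ring
  rw [h6]
  linarith

/-- First differences of `u` on the inner ball are controlled by those of `u η`. -/
lemma IsCutoff.eLpNorm_fdiff_restrict_le (hη : IsCutoff c x₀ r R η) (hrR : r < R) {q : ℝ≥0∞}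
    (hq : 1 ≤ q) (hU : MemLp ((closedBall x₀ R).indicator u) q volume) {h : RN N}
    (hh : ‖h‖ ≤ R - r) :
    eLpNorm (fdiff h u) q (volume.restrict (ball x₀ r)) ≤
      2 * eLpNorm (fdiff h (fun x => u x * η x)) q volume +
        ENNReal.ofReal ((4 * c + 4) * ‖h‖ / (R - r)) *
          eLpNorm ((closedBall x₀ R).indicator u) q volume := by
  set U := (closedBall x₀ R).indicator u with hUd
  have hc := hη.const_nonneg hrR
  have hRr : 0 < R - r := by linarith
  have hUv : (fun x => u x * η x) = fun x => U x * η x := hη.mul_eq_indicator_mul hrR u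
  have huU : ∀ x ∈ ball x₀ r, fdiff h u x = fdiff h U x := by
    intro x hx
    rw [mem_ball] at hx
    have h1 : x ∈ closedBall x₀ R := by rw [mem_closedBall]; linarith
    have h2 : x + h ∈ closedBall x₀ R := by
      have := dist_triangle (x + h) x x₀
      have d : dist (x + h) x = ‖h‖ := by simp
      rw [mem_closedBall]; linarith
    simp only [fdiff, hUd, indicator_of_mem h1, indicator_of_mem h2]
  have hae : ∀ᵐ x ∂(volume.restrict (ball x₀ r)), fdiff h u x = fdiff h U x :=
    (ae_restrict_mem measurableSet_ball).mono huU
  rw [eLpNorm_congr_ae hae, hUv]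
  -- In the second case `4 c |h| / (R - r) > 2`, and the trivial bound by twice the norm of `U`
  -- suffices.
  rcases le_or_gt (2 * c * ‖h‖) (R - r) with hle | hgt
  · set k := 2 * c * ‖h‖ / (R - r) with hk
    have hk0 : 0 ≤ k := by positivity
    have hv := (hη.memLp_mul hU).fdiff h
    have hb : ∀ᵐ x ∂(volume.restrict (ball x₀ r)), ‖fdiff h U x‖ ≤
        ((fun x => 2 * ‖fdiff h (fun x => U x * η x) x‖) + fun x => k * ‖U x‖) x :=
      (ae_restrict_mem measurableSet_ball).mono fun x hx => hη.norm_fdiff_le hrR hx hle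
    refine (eLpNorm_mono_ae_real hb).trans ?_
    refine (eLpNorm_mono_measure _ Measure.restrict_le_self).trans ?_
    refine (eLpNorm_add_le (hv.1.norm.const_mul 2) (hU.1.norm.const_mul k) hq).trans ?_
    have e1 : (fun x => 2 * ‖fdiff h (fun x => U x * η x) x‖) =
      (2 : ℝ) • fun x => ‖fdiff h (fun x => U x * η x) x‖ := rfl
    have e2 : (fun x => k * ‖U x‖) = k • fun x => ‖U x‖ := rfl
    rw [e1, e2, eLpNorm_const_smul, eLpNorm_const_smul, eLpNorm_norm, eLpNorm_norm,
      Real.enorm_eq_ofReal hk0, Real.enorm_eq_ofReal (by norm_num : (0 : ℝ) ≤ 2)]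
    gcongr
    · simp
    · rw [hk]
      gcongr
      linarith
  · refine (eLpNorm_mono_measure _ Measure.restrict_le_self).trans ?_
    refine (eLpNorm_fdiff_le hU.1 hq h).trans (le_trans ?_ le_add_self)
    gcongr
    refine (ENNReal.ofReal_ofNat 2).symm.le.trans (ENNReal.ofReal_le_ofReal ?_)
    rw [le_div_iff₀ hRr]
    nlinarith [norm_nonneg h]

end Cutoff

/-! ### Nikol'skii and gradient estimates from second differences -/

section Consequences

variable {N : ℕ} {p Γ k h₀ T : ℝ} {v u η : RN N → ℝ} {c r R : ℝ} {x₀ : RN N}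

lemma nikolskii_le {τ D : ℝ} {A : Set (RN N)}
    (h : ∀ h : RN N, h ≠ 0 → ‖h‖ < h₀ →
      eLpNorm (fdiff h u) (ENNReal.ofReal p) (volume.restrict A) ≤ ENNReal.ofReal (D * ‖h‖ ^ τ)) :
    nikolskii τ p h₀ u A ≤ ENNReal.ofReal D := by
  refine iSup₂_le fun w hw => ?_
  have e : (fun x => fdiff w u x / ‖w‖ ^ τ) = (‖w‖ ^ τ)⁻¹ • fdiff w u := by
    ext x; simp [div_eq_inv_mul]
  have hn := hw.1
  rw [lpNormOn, e, eLpNorm_const_smul, Real.enorm_eq_ofReal (by positivity)]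
  grw [h w (norm_pos_iff.1 hn) hw.2]
  rw [← ENNReal.ofReal_mul (by positivity)]
  refine ENNReal.ofReal_le_ofReal (le_of_eq ?_)
  field_simp

/-- Lowering the order of the second differences, for small orders. -/
lemma eLpNorm_fdiff2_le_of_order_le {q : ℝ≥0∞} (hq : 1 ≤ q) (hv : MemLp v q volume) (hk : 0 ≤ k)
    (hT : 0 ≤ T) (hh₀ : 0 < h₀)
    (hh₁ : h₀ ≤ 1) (h2 : ∀ h, eLpNorm (fdiff2 h v) q volume ≤ ENNReal.ofReal (k * T * ‖h‖ ^ Γ))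
    (hvT : eLpNorm v q volume ≤ ENNReal.ofReal (h₀ ^ Γ * T)) {τ : ℝ} (hτ : 0 < τ) (hτΓ : τ ≤ Γ)
    (h : RN N) :
    eLpNorm (fdiff2 h v) q volume ≤ ENNReal.ofReal ((k + 4) * T * ‖h‖ ^ τ) := by
  rcases eq_or_ne h 0 with rfl | hne
  · simp [fdiff2_zero]
  have hn : 0 < ‖h‖ := norm_pos_iff.2 hne
  rcases lt_or_ge ‖h‖ h₀ with hlt | hge
  · refine (h2 h).trans (ENNReal.ofReal_le_ofReal ?_)
    have : ‖h‖ ^ Γ ≤ ‖h‖ ^ τ := Real.rpow_le_rpow_of_exponent_ge hn (by linarith) hτΓ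
    gcongr
    linarith
  · grw [eLpNorm_fdiff2_le hv hq h, hvT]
    rw [show (4 : ℝ≥0∞) = ENNReal.ofReal 4 by simp, ← ENNReal.ofReal_mul (by norm_num)]
    refine ENNReal.ofReal_le_ofReal ?_
    have h1 : h₀ ^ Γ ≤ h₀ ^ τ := Real.rpow_le_rpow_of_exponent_ge hh₀ hh₁ hτΓ
    have h3 : h₀ ^ τ ≤ ‖h‖ ^ τ := by gcongr
    calc 4 * (h₀ ^ Γ * T) ≤ 4 * (‖h‖ ^ τ * T) := by gcongr; exact h1.trans h3
      _ = 4 * T * ‖h‖ ^ τ := by ring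
      _ ≤ _ := by gcongr; linarith

/-- Nikol'skii regularity of order `τ < 1`, `τ ≤ Γ`, from second differences of order `Γ`. -/
lemma nikolskii_le_of_fdiff2 (hp : 1 ≤ p) (hη : IsCutoff c x₀ r R η) (hrR : r < R) (hk : 0 ≤ k)
    (hT : 0 ≤ T) (hh₀ : 0 < h₀) (hh₁ : h₀ ≤ 1) (hhR : h₀ ≤ R - r)
    (h2 : ∀ h, eLpNorm (fdiff2 h fun x => u x * η x) (ENNReal.ofReal p) volume ≤
      ENNReal.ofReal (k * T * ‖h‖ ^ Γ))
    (hU : MemLp ((closedBall x₀ R).indicator u) (ENNReal.ofReal p) volume)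
    (hUT : eLpNorm ((closedBall x₀ R).indicator u) (ENNReal.ofReal p) volume ≤
      ENNReal.ofReal (h₀ ^ Γ * T)) {τ : ℝ} (hτ : 0 < τ) (hτ1 : τ < 1) (hτΓ : τ ≤ Γ) :
    nikolskii τ p h₀ u (ball x₀ r) ≤ ENNReal.ofReal ((2 * k + 4 * c + 12) / (1 - τ) * T) := by
  have hq : 1 ≤ ENNReal.ofReal p := by simpa using hp
  have hc := hη.const_nonneg hrR
  have hRr : 0 < R - r := by linarith
  have hτ1' : 0 < 1 - τ := by linarith
  have hv : MemLp (fun x => u x * η x) (ENNReal.ofReal p) volume := by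
    rw [hη.mul_eq_indicator_mul hrR]; exact hη.memLp_mul hU
  have hvT : eLpNorm (fun x => u x * η x) (ENNReal.ofReal p) volume ≤
      ENNReal.ofReal (h₀ ^ Γ * T) := by
    rw [hη.mul_eq_indicator_mul hrR]
    exact (eLpNorm_mono (hη.norm_mul_le _)).trans hUT
  refine nikolskii_le fun h hne hh => ?_
  have hn : 0 < ‖h‖ := norm_pos_iff.2 hne
  grw [hη.eLpNorm_fdiff_restrict_le hrR hq hU (by linarith), hUT,
    eLpNorm_fdiff_le_of_fdiff2 hv hq (K := (k + 4) * T) (by positivity) hτ.le hτ1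
      (eLpNorm_fdiff2_le_of_order_le hq hv hk hT hh₀ hh₁ h2 hvT hτ hτΓ) h]
  rw [two_mul, ← ENNReal.ofReal_add (by positivity) (by positivity), ← two_mul,
    ← ENNReal.ofReal_mul (by positivity), ← ENNReal.ofReal_add (by positivity) (by positivity)]
  refine ENNReal.ofReal_le_ofReal ?_
  -- The cut-off error is of order `|h|`. Spending `|h|^{1-τ} ≤ h₀^{1-τ}` leaves `h₀^{1-τ+Γ} ≤ h₀ ≤
  -- R - r`, since `h₀ ≤ 1` and `τ ≤ Γ`.
  have h1 : ‖h‖ / (R - r) * h₀ ^ Γ ≤ ‖h‖ ^ τ := by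
    have e1 : ‖h‖ ≤ ‖h‖ ^ τ * h₀ ^ (1 - τ) := by
      calc ‖h‖ = ‖h‖ ^ τ * ‖h‖ ^ (1 - τ) := by
            rw [← Real.rpow_add hn, add_sub_cancel, Real.rpow_one]
        _ ≤ _ := by gcongr
    have e2 : h₀ ^ (1 - τ) * h₀ ^ Γ ≤ R - r := by
      rw [← Real.rpow_add hh₀]
      refine le_trans ?_ hhR
      simpa using Real.rpow_le_rpow_of_exponent_ge hh₀ hh₁ (by linarith : 1 ≤ 1 - τ + Γ)
    rw [div_mul_eq_mul_div, div_le_iff₀ hRr]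
    calc ‖h‖ * h₀ ^ Γ ≤ ‖h‖ ^ τ * h₀ ^ (1 - τ) * h₀ ^ Γ := by gcongr
      _ = ‖h‖ ^ τ * (h₀ ^ (1 - τ) * h₀ ^ Γ) := by ring
      _ ≤ _ := by gcongr
  have h3 : 4 * c + 4 ≤ (4 * c + 4) / (1 - τ) := le_div_self (by linarith) hτ1' (by linarith)
  calc 2 * ((k + 4) * T / (1 - τ) * ‖h‖ ^ τ) + (4 * c + 4) * ‖h‖ / (R - r) * (h₀ ^ Γ * T)
      = 2 * ((k + 4) * T / (1 - τ) * ‖h‖ ^ τ) + (4 * c + 4) * (‖h‖ / (R - r) * h₀ ^ Γ) * T := by ring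
    _ ≤ 2 * ((k + 4) * T / (1 - τ) * ‖h‖ ^ τ) + (4 * c + 4) / (1 - τ) * ‖h‖ ^ τ * T := by gcongr
    _ = _ := by ring

lemma isWeakGradientOn_of_global (hq : 1 ≤ p) {S : Set (RN N)} (hS : MeasurableSet S)
    {G : RN N → RN N} (hv : MemLp v (ENNReal.ofReal p) volume)
    (hG : MemLp G (ENNReal.ofReal p) volume) (huv : ∀ x ∈ S, u x = v x)
    (hw : ∀ φ : RN N → ℝ, ContDiff ℝ ∞ φ → HasCompactSupport φ → ∀ w : RN N,
        ∫ x, v x * fderiv ℝ φ x w = -∫ x, inner ℝ (G x) w * φ x) :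
    IsWeakGradientOn u G S := by
  have hq' : 1 ≤ ENNReal.ofReal p := by simpa using hq
  refine ⟨?_, (hG.locallyIntegrable hq').locallyIntegrableOn S, fun φ hφ hc hs w => ?_⟩
  · intro x hx
    obtain ⟨t, ht, hi⟩ := (hv.locallyIntegrable hq').locallyIntegrableOn S x hx
    refine ⟨t ∩ S, Filter.inter_mem ht self_mem_nhdsWithin, ?_⟩
    have hcongr : v =ᵐ[volume.restrict (S ∩ t)] u := by
      rw [← Measure.restrict_restrict hS]
      exact (ae_restrict_mem hS).mono fun x hx => (huv x hx).symm
    have := (hi.mono_set (inter_subset_right (s := S))).congr hcongr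
    rwa [inter_comm] at this
  · have hφ0 : ∀ x, x ∉ S → φ x = 0 := fun x hx => image_eq_zero_of_notMem_tsupport
      (fun hc => hx (hs hc))
    have hφ1 : ∀ x, x ∉ S → fderiv ℝ φ x = 0 := fun x hx => image_eq_zero_of_notMem_tsupport
      (fun hc => hx (hs (tsupport_fderiv_subset ℝ hc)))
    rw [setIntegral_congr_fun (g := fun x => v x * fderiv ℝ φ x w) hS
      (fun x hx => by simp only [huv x hx]),
      setIntegral_eq_integral_of_forall_compl_eq_zero (fun x hx => by simp [hφ1 x hx]),
      setIntegral_eq_integral_of_forall_compl_eq_zero (fun x hx => by simp [hφ0 x hx])]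
    exact hw φ hφ hc w

/-- Weak differentiability and fractional regularity of the gradient from second differences of
order `Γ > 1`. -/
lemma exists_gradient_of_fdiff2 (hN : 1 ≤ N) (hp : 1 ≤ p) (hv : Integrable v)
    (hvp : MemLp v (ENNReal.ofReal p) volume)
    (hk : 0 ≤ k) (hT : 0 ≤ T) (hh₀ : 0 < h₀) (hh₁ : h₀ ≤ 1) (hΓ : 1 < Γ) (hΓ2 : Γ ≤ 2)
    (h2 : ∀ h, eLpNorm (fdiff2 h v) (ENNReal.ofReal p) volume ≤ ENNReal.ofReal (k * T * ‖h‖ ^ Γ))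
    (hvT : eLpNorm v (ENNReal.ofReal p) volume ≤ ENNReal.ofReal (h₀ ^ Γ * T)) :
    ∃ G : RN N → RN N, MemLp G (ENNReal.ofReal p) volume ∧
      (∀ φ : RN N → ℝ, ContDiff ℝ ∞ φ → HasCompactSupport φ → ∀ w : RN N,
        ∫ x, v x * fderiv ℝ φ x w = -∫ x, inner ℝ (G x) w * φ x) ∧
      eLpNorm G (ENNReal.ofReal p) volume ≤ ENNReal.ofReal (N * (k + 2) / (Γ - 1) * T) ∧
      ∀ τ : ℝ, 0 < τ → τ < Γ - 1 → ∀ S : Set (RN N), gagliardo τ p G S ^ p ≤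
        ENNReal.ofReal (N * (volume (ball (0 : RN N) 1)).toReal * (N * (8 * k + 4)) ^ p /
          ((Γ - 1 - τ) * τ) * (h₀ ^ (-τ) / (Γ - 1)) ^ p * T ^ p) := by
  have hp0 : 0 < p := by linarith
  have hΓ1 : 0 < Γ - 1 := by linarith
  obtain ⟨G, hG, hGn, hGd, hGw⟩ := exists_weak_gradient (K := k * T) (by simpa using hp) hv hvp
    (by positivity) hΓ hΓ2 h2 hh₀
  have hGL : eLpNorm G (ENNReal.ofReal p) volume ≤ ENNReal.ofReal (N * (k + 2) / (Γ - 1) * T) := by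
    grw [hGn, hvT]
    rw [← ENNReal.ofReal_mul (by positivity), ← ENNReal.ofReal_add (by positivity) (by positivity),
      ← ENNReal.ofReal_natCast, ← ENNReal.ofReal_mul (by positivity)]
    refine ENNReal.ofReal_le_ofReal ?_
    have h1 : h₀ ^ (Γ - 1) ≤ 1 := Real.rpow_le_one hh₀.le hh₁ hΓ1.le
    have h3 : 2 / h₀ * (h₀ ^ Γ * T) = 2 * h₀ ^ (Γ - 1) * T := by
      rw [Real.rpow_sub hh₀, Real.rpow_one]; ring
    have h4 : T ≤ T / (Γ - 1) := le_div_self hT hΓ1 (by linarith)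
    rw [h3]
    calc (N : ℝ) * (k * T / (Γ - 1) * h₀ ^ (Γ - 1) + 2 * h₀ ^ (Γ - 1) * T) ≤
        N * (k * T / (Γ - 1) * 1 + 2 * 1 * (T / (Γ - 1))) := by gcongr
      _ = _ := by ring
  refine ⟨G, hG, hGw, hGL, fun τ hτ hτΓ S => ?_⟩
  have hβ : 0 < Γ - 1 - τ := by linarith
  have hd : ∀ h, h ≠ 0 → ‖h‖ ≤ h₀ → eLpNorm (fun x => G (x + h) - G x) (ENNReal.ofReal p) volume ≤
      ENNReal.ofReal (N * (8 * (k * T) / (Γ - 1)) * ‖h‖ ^ (Γ - 1)) := by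
    intro h hh hh'
    refine (hGd h hh hh').trans (le_of_eq ?_)
    rw [← ENNReal.ofReal_natCast, ← ENNReal.ofReal_mul (by positivity), mul_assoc]
  refine (gagliardo_rpow_le hN hp hτ hτΓ hh₀ (by positivity) (by positivity) hG.1 hGL hd S).trans ?_
  refine ENNReal.ofReal_le_ofReal ?_
  set w := (volume (ball (0 : RN N) 1)).toReal
  have hw : 0 ≤ w := ENNReal.toReal_nonneg
  set E := N * (8 * k + 4) / (Γ - 1) * T with hE
  have hE0 : 0 ≤ E := by positivity
  have hA : N * (8 * (k * T) / (Γ - 1)) ≤ E := by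
    have : N * (8 * (k * T) / (Γ - 1)) = N * (8 * k) / (Γ - 1) * T := by ring
    rw [this, hE]; gcongr; linarith
  have hB : 2 * (N * (k + 2) / (Γ - 1) * T) ≤ E := by
    have : 2 * (N * (k + 2) / (Γ - 1) * T) = N * (2 * k + 4) / (Γ - 1) * T := by ring
    rw [this, hE]; gcongr; linarith
  have ha : h₀ ^ ((Γ - 1 - τ) * p) ≤ h₀ ^ (-(τ * p)) :=
    Real.rpow_le_rpow_of_exponent_ge hh₀ hh₁ (by nlinarith [mul_pos hβ hp0, mul_pos hτ hp0])
  -- The near and far contributions add up to `(Γ - 1) / p` times the right side, and `Γ - 1 ≤ 1 ≤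
  -- p`.
  have hsum : 1 / ((Γ - 1 - τ) * p) + 1 / (τ * p) ≤ 1 / ((Γ - 1 - τ) * τ) := by
    have : 1 / ((Γ - 1 - τ) * p) + 1 / (τ * p) = (Γ - 1) / p * (1 / ((Γ - 1 - τ) * τ)) := by
      field_simp; ring
    rw [this]
    refine mul_le_of_le_one_left (by positivity) ?_
    rw [div_le_one hp0]; linarith
  have hEp : E ^ p = (N * (8 * k + 4)) ^ p / (Γ - 1) ^ p * T ^ p := by
    rw [hE, Real.mul_rpow (by positivity) hT, Real.div_rpow (by positivity) hΓ1.le]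
  calc _ ≤ N * w * (E ^ p * h₀ ^ (-(τ * p)) / ((Γ - 1 - τ) * p) +
        E ^ p * h₀ ^ (-(τ * p)) / (τ * p)) := by gcongr
    _ = N * w * (E ^ p * h₀ ^ (-(τ * p))) * (1 / ((Γ - 1 - τ) * p) + 1 / (τ * p)) := by ring
    _ ≤ N * w * (E ^ p * h₀ ^ (-(τ * p))) * (1 / ((Γ - 1 - τ) * τ)) := by gcongr
    _ = _ := by
      rw [hEp, Real.div_rpow (by positivity) hΓ1.le, ← Real.rpow_mul hh₀.le, neg_mul]
      ring

end Consequences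

/-! ### Assembly of the theorem -/

lemma lt_of_ofReal_lt_quarter_mul_min {a b : ℝ} {d : ℝ≥0∞} (ha : 0 < a)
    (h : ENNReal.ofReal a < (1 / 4) * min d (min (ENNReal.ofReal b) 1)) :
    a < b / 4 ∧ a < 1 / 4 := by
  have e : (1 / 4 : ℝ≥0∞) = ENNReal.ofReal (1 / 4) := by
    rw [ENNReal.ofReal_div_of_pos (by norm_num)]; simp
  have h1 : ENNReal.ofReal a < ENNReal.ofReal (b / 4) := by
    refine h.trans_le ?_
    grw [min_le_right, min_le_left]
    rw [e, ← ENNReal.ofReal_mul (by norm_num)]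
    exact ENNReal.ofReal_le_ofReal (by linarith)
  have h2 : ENNReal.ofReal a < ENNReal.ofReal (1 / 4) := by
    refine h.trans_le ?_
    grw [min_le_right, min_le_right]
    rw [e, mul_one]
  exact ⟨(ENNReal.ofReal_lt_ofReal_iff_of_nonneg ha.le).1 h1,
    (ENNReal.ofReal_lt_ofReal_iff_of_nonneg ha.le).1 h2⟩

theorem lemma3p3 (N : ℕ) (hN : 1 ≤ N) (c : ℝ) (p : ℝ) (hp : 2 ≤ p) :
    ∃ C : ℝ, 0 < C ∧
      ∀ (s t γ Γ : ℝ), 0 < s → s < 1 → 0 ≤ t → t ≤ s → s ≤ γ → γ ≤ 1 →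
        Γ = (γ + t + s * p) / p →
      ∀ (Ω : Set (RN N)), IsOpen Ω →
      ∀ (x₀ : RN N) (r R h₀ : ℝ), 0 < r → r < R → closedBall x₀ R ⊆ Ω →
        0 < h₀ →
        ENNReal.ofReal h₀ <
          (1 / 4) * min (setDist (ball x₀ R) (frontier Ω)) (min (ENNReal.ofReal (R - r)) 1) →
      ∀ (η : RN N → ℝ), IsCutoff c x₀ r R η →
      ∀ (u : RN N → ℝ), MemLpLoc p u Ω →
      ∀ (M B : ℝ≥0∞),
        M = supGagliardo ((γ + t) / p) s p h₀ (fun x => u x * η x) (ball x₀ R) →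
        M < ⊤ →
        B = ENNReal.ofReal (1 - s) * M +
          ENNReal.ofReal (h₀ ^ (-(Γ * p))) * lpNormOn p u (ball x₀ (R + h₀)) ^ p →
        (MemBesov Γ p (fun x => u x * η x) ∧
          besovSeminorm Γ p (fun x => u x * η x) ^ p ≤
            ENNReal.ofReal (C / s * (R / r) ^ N * (R / h₀) ^ (1 + p)) * B) ∧
        (Γ < 1 →
          nikolskii Γ p h₀ u (ball x₀ r) < ⊤ ∧
          nikolskii Γ p h₀ u (ball x₀ r) ^ p ≤
            ENNReal.ofReal (C / (s * (1 - Γ) ^ p) * (R / r) ^ N * (R / h₀) ^ (1 + p)) * B) ∧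
        (Γ = 1 → ∀ τ : ℝ, 0 < τ → τ < 1 →
          nikolskii τ p h₀ u (ball x₀ r) < ⊤ ∧
          nikolskii τ p h₀ u (ball x₀ r) ^ p ≤
            ENNReal.ofReal (C / (1 - τ) ^ p * (R / r) ^ N * (R / h₀) ^ (1 + p)) * B) ∧
        (1 < Γ → ∃ G : RN N → RN N,
          IsWeakGradientOn u G (ball x₀ r) ∧
          MemLpOn p G (ball x₀ r) ∧
          lpNormOn p G (ball x₀ r) ^ p ≤
            ENNReal.ofReal (C / (Γ - 1) ^ p * (R / r) ^ N * (R / h₀) ^ (1 + p)) * B ∧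
          ∀ τ : ℝ, 0 < τ → τ < Γ - 1 →
            MemFracSobolev τ p G (ball x₀ r) ∧
            gagliardo τ p G (ball x₀ r) ^ p ≤
              ENNReal.ofReal (C * (R / r) ^ N / ((Γ - 1 - τ) * τ) * (R / h₀) ^ (1 + p) *
                (h₀ ^ (-τ) / ((2 - Γ) * (Γ - 1))) ^ p) * B) := by
  have hp0 : 0 < p := by linarith
  have hp1 : 1 ≤ p := by linarith
  have hq : 1 ≤ ENNReal.ofReal p := by simpa using hp1
  set k : ℝ := (nikolskiiConst N p + 4 ^ p) ^ (1 / p) with hkd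
  have hκ := nikolskiiConst_pos (N := N) hp0
  have hk : 0 ≤ k := by positivity
  have hw := volume_unitBall_pos (N := N)
  set w := (volume (ball (0 : RN N) 1)).toReal with hwd
  set C₁ : ℝ := k ^ p with hC₁
  -- The constant is chosen before any cut-off is given, hence `|c|`. The existence of `η` later
  -- forces `0 ≤ c`.
  set C₂ : ℝ := (2 * k + 4 * |c| + 12) ^ p with hC₂
  set C₃ : ℝ := (N * (k + 2)) ^ p with hC₃
  set C₄ : ℝ := N * w * (N * (8 * k + 4)) ^ p with hC₄
  have h₁ : 0 ≤ C₁ := by positivity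
  have h₂ : 0 ≤ C₂ := by positivity
  have h₃ : 0 ≤ C₃ := by positivity
  have h₄ : 0 ≤ C₄ := by positivity
  refine ⟨C₁ + C₂ + C₃ + C₄ + 1, by positivity, ?_⟩
  set C := C₁ + C₂ + C₃ + C₄ + 1 with hC
  have hC0 : 0 < C := by positivity
  intro s t γ Γ hs0 hs1 ht hts hsγ hγ hΓ Ω _ x₀ r R h₀ hr hrR hRΩ hh₀ hh η hη u hu M B hM hMfin hB
  obtain ⟨hhR, hh1⟩ := lt_of_ofReal_lt_quarter_mul_min hh₀ hh
  have hc := hη.const_nonneg hrR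
  rw [abs_of_nonneg hc] at hC₂
  have hΓθ : Γ = (γ + t) / p + s := by rw [hΓ]; field_simp
  have hγt : 0 ≤ γ + t := by linarith
  have hθ : 0 ≤ (γ + t) / p := by positivity
  have hΓ0 : 0 < Γ := by rw [hΓθ]; positivity
  -- By `p ≥ 2`, `Γ ≤ (γ + t) / 2 + s`, with `γ ≤ 1` and `t ≤ s < 1`.
  have hΓ2 : Γ < 2 := by
    have : (γ + t) / p ≤ (γ + t) / 2 := by gcongr
    rw [hΓθ]; linarith
  set q := ENNReal.ofReal p with hqd
  set U := (closedBall x₀ R).indicator u with hUd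
  have hU : MemLp U q volume := (memLp_indicator_iff_restrict measurableSet_closedBall).2
    (hu _ (isCompact_closedBall x₀ R) hRΩ)
  set v : RN N → ℝ := fun x => u x * η x with hvd
  have hvU : v = fun x => U x * η x := hη.mul_eq_indicator_mul hrR u
  have hv : MemLp v q volume := by rw [hvU]; exact hη.memLp_mul hU
  have hvn : eLpNorm v q volume ≤ eLpNorm U q volume := by
    rw [hvU]; exact eLpNorm_mono (hη.norm_mul_le _)
  have hv0 : ∀ x, x ∉ ball x₀ ((R + r) / 2) → v x = 0 := fun x hx => by
    simp [hvd, hη.eq_zero x hx]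
  have hvi : Integrable v := by
    rw [← integrableOn_iff_integrable_of_support_subset (s := ball x₀ ((R + r) / 2))]
    · have : IsFiniteMeasure (volume.restrict (ball x₀ ((R + r) / 2))) :=
        ⟨by simpa using measure_ball_lt_top⟩
      exact (hv.restrict _).integrable hq
    · intro x hx
      by_contra hc
      exact hx (hv0 x hc)
  -- A smaller energy, with the norm taken over the closed ball of radius `R`. It is finite because
  -- that ball is compact in `Ω`, so its `p`-th root `T` can be a real number.
  set B' : ℝ≥0∞ := ENNReal.ofReal (1 - s) * M +
    ENNReal.ofReal (h₀ ^ (-(Γ * p))) * eLpNorm U q volume ^ p with hB'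
  have hB'B : B' ≤ B := by
    rw [hB, hB']
    gcongr
    rw [hUd, eLpNorm_indicator_eq_eLpNorm_restrict measurableSet_closedBall]
    exact eLpNorm_mono_measure _ (Measure.restrict_mono
      (closedBall_subset_ball (by linarith)) le_rfl)
  have hB'fin : B' ≠ ⊤ := ENNReal.add_ne_top.2 ⟨ENNReal.mul_ne_top (by simp) hMfin.ne,
    ENNReal.mul_ne_top (by simp) (ENNReal.rpow_ne_top_of_nonneg hp0.le hU.2.ne)⟩
  set T : ℝ := B'.toReal ^ (1 / p) with hT
  have hT0 : 0 ≤ T := by positivity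
  have hTB' : ENNReal.ofReal (T ^ p) = B' := by
    rw [hT, ← Real.rpow_mul ENNReal.toReal_nonneg, one_div, inv_mul_cancel₀ hp0.ne', Real.rpow_one,
      ENNReal.ofReal_toReal hB'fin]
  have hTB : ENNReal.ofReal (T ^ p) ≤ B := hTB'.trans_le hB'B
  have hUT : eLpNorm U q volume ≤ ENNReal.ofReal (h₀ ^ Γ * T) := by
    have h1 : eLpNorm U q volume ^ p ≤
        ENNReal.ofReal (h₀ ^ (Γ * p)) * ENNReal.ofReal (T ^ p) := by
      rw [hTB', hB']
      grw [← le_add_self (a := ENNReal.ofReal (h₀ ^ (-(Γ * p))) * eLpNorm U q volume ^ p)]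
      rw [← mul_assoc, ← ENNReal.ofReal_mul (by positivity), ← Real.rpow_add hh₀]
      simp
    have h2 := le_ofReal_mul_of_rpow_le hp0 (by positivity) hT0 h1
    rwa [← Real.rpow_mul hh₀.le, mul_assoc, mul_one_div_cancel hp0.ne', mul_one] at h2
  have hvT := hvn.trans hUT
  have h2 : ∀ h, eLpNorm (fdiff2 h v) q volume ≤ ENNReal.ofReal (k * T * ‖h‖ ^ Γ) := by
    intro h
    rcases eq_or_ne h 0 with rfl | hne
    · simp [fdiff2_zero]
    -- The support condition is `(R + r) / 2 + 2 h₀ ≤ R`, which follows from `h₀ < (R - r) / 4`.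
    have hX := eLpNorm_fdiff2_rpow_le hN hp1 hs0 hs1 hθ (x₀ := x₀) (R := R) hh₀ (by linarith) hv hv0
      (hM ▸ hMfin) hne
    rw [← hΓθ, ← hM] at hX
    grw [hvn] at hX
    rw [← hB', ← hTB'] at hX
    have hX' := le_ofReal_mul_of_rpow_le hp0 (by positivity) hT0 hX
    rw [Real.mul_rpow (by positivity) (by positivity), ← hkd, ← Real.rpow_mul (norm_nonneg h),
      mul_assoc Γ, mul_one_div_cancel hp0.ne', mul_one] at hX'
    refine hX'.trans_eq ?_
    congr 1; ring
  have hQ1 : 1 ≤ (R / r) ^ N := one_le_pow₀ ((one_le_div hr).2 hrR.le)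
  have hQ2 : 1 ≤ (R / h₀) ^ (1 + p) :=
    Real.one_le_rpow ((one_le_div hh₀).2 (by linarith)) (by linarith)
  set Q₁ := (R / r) ^ N
  set Q₂ := (R / h₀) ^ (1 + p)
  have hQ : ∀ a b : ℝ, 0 ≤ b → a ≤ b → a ≤ b * Q₁ * Q₂ := fun a b hb hab =>
    hab.trans ((le_mul_of_one_le_right hb hQ1).trans
      (le_mul_of_one_le_right (by positivity) hQ2))
  have hnik : ∀ τ, 0 < τ → τ < 1 → τ ≤ Γ → nikolskii τ p h₀ u (ball x₀ r) ≤
      ENNReal.ofReal ((2 * k + 4 * c + 12) / (1 - τ) * T) := fun τ hτ hτ1 hτΓ =>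
    nikolskii_le_of_fdiff2 hp1 hη hrR hk hT0 hh₀ (by linarith) (by linarith) h2 hU hUT hτ hτ1 hτΓ
  have hbes := besovSeminorm_le h2
  refine ⟨⟨⟨?_, hbes.trans_lt ENNReal.ofReal_lt_top⟩, ?_⟩, fun hΓ1 => ?_, fun hΓ1 τ hτ hτ1 => ?_,
    fun hΓ1 => ?_⟩
  · rw [MemLpOn, Measure.restrict_univ]; exact hv
  · refine rpow_le_of_le_ofReal_mul hp0 hk hT0 hbes (hQ _ _ (by positivity) ?_) hTB
    refine le_trans ?_ (le_div_self hC0.le hs0 hs1.le)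
    linarith
  · have hn := hnik Γ hΓ0 hΓ1 le_rfl
    have h1Γ : 0 < 1 - Γ := by linarith
    refine ⟨hn.trans_lt ENNReal.ofReal_lt_top,
      rpow_le_of_le_ofReal_mul hp0 (by positivity) hT0 hn (hQ _ _ (by positivity) ?_) hTB⟩
    rw [Real.div_rpow (by positivity) h1Γ.le, ← hC₂]
    gcongr
    · linarith
    · exact mul_le_of_le_one_left (by positivity) hs1.le
  · have hn := hnik τ hτ hτ1 (by linarith)
    have h1τ : 0 < 1 - τ := by linarith
    refine ⟨hn.trans_lt ENNReal.ofReal_lt_top,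
      rpow_le_of_le_ofReal_mul hp0 (by positivity) hT0 hn (hQ _ _ (by positivity) ?_) hTB⟩
    rw [Real.div_rpow (by positivity) h1τ.le, ← hC₂]
    gcongr
    linarith
  · have hβ : 0 < Γ - 1 := by linarith
    have h2Γ : 0 < 2 - Γ := by linarith
    obtain ⟨G, hG, hGw, hGL, hGg⟩ := exists_gradient_of_fdiff2 hN hp1 hvi hv hk hT0 hh₀ (by linarith)
      hΓ1 hΓ2.le h2 hvT
    have hGr : lpNormOn p G (ball x₀ r) ≤ ENNReal.ofReal (N * (k + 2) / (Γ - 1) * T) :=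
      (eLpNorm_mono_measure _ Measure.restrict_le_self).trans hGL
    refine ⟨G, isWeakGradientOn_of_global hp1 measurableSet_ball hv hG
      (fun x hx => by simp [hvd, hη.eq_one x hx]) hGw, hG.restrict _,
      rpow_le_of_le_ofReal_mul hp0 (by positivity) hT0 hGr (hQ _ _ (by positivity) ?_) hTB,
      fun τ hτ hτΓ => ?_⟩
    · rw [Real.div_rpow (by positivity) hβ.le, ← hC₃]
      gcongr
      linarith
    · have hg := hGg τ hτ hτΓ (ball x₀ r)
      have hβτ : 0 < Γ - 1 - τ := by linarith
      refine ⟨⟨hG.restrict _, ?_⟩, hg.trans ?_⟩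
      · refine (ENNReal.rpow_lt_top_iff_of_pos hp0).1 (hg.trans_lt ENNReal.ofReal_lt_top)
      · rw [← hC₄, ENNReal.ofReal_mul (by positivity)]
        refine mul_le_mul' (ENNReal.ofReal_le_ofReal ?_) hTB
        -- Here `0 < 2 - Γ ≤ 1`, so inserting this factor only weakens the estimate.
        have hD : h₀ ^ (-τ) / (Γ - 1) ≤ h₀ ^ (-τ) / ((2 - Γ) * (Γ - 1)) := by
          gcongr
          exact mul_le_of_le_one_left hβ.le (by linarith)
        have hC₄C : C₄ ≤ C := by linarith
        calc C₄ / ((Γ - 1 - τ) * τ) * (h₀ ^ (-τ) / (Γ - 1)) ^ p ≤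
            C / ((Γ - 1 - τ) * τ) * Q₁ * Q₂ * (h₀ ^ (-τ) / ((2 - Γ) * (Γ - 1))) ^ p := by
              refine mul_le_mul (hQ _ _ (by positivity) (by gcongr)) ?_ (by positivity)
                (by positivity)
              gcongr
          _ = _ := by ring
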